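/- Let $E$ be an elliptic curve over $\mathbb{Q}$ and, for $n \ge 1$, let $\mathbb{Q}(E[n]) \subset \overline{\mathbb{Q}}$ be the field generated over $\mathbb{Q}$ by the coordinates of all points $P \in E(\overline{\mathbb{Q}})$ with $nP = O$. Let $\Delta_E$ be the discriminant of a Weierstrass equation of $E$ over $\mathbb{Q}$, and let $\Delta_E^{sf}$ be its squarefree part, that is, the unique squarefree integer (with sign) such that $\Delta_E = \Delta_E^{sf} q^2$ for some $q \in \mathbb{Q}^\times$; it does not depend on the chosen equation. Let $\zeta_3 \in \overline{\mathbb{Q}}$ be a primitive cube root of unity. Suppose that $\mathbb{Q}(E[3]) = \mathbb{Q}(\zeta_3)$ and that $3 \mid \Delta_E^{sf}$. Define the positive integer $m$ by $$3m = \begin{cases} 2\,|\Delta_E^{sf}| & \text{if } \Delta_E^{sf} \equiv 1 \pmod 4, \\ 4\,|\Delta_E^{sf}| & \text{otherwise.} \end{cases}$$ Then $\mathbb{Q}(E[m]) = \mathbb{Q}(E[3m])$. -/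

import Mathlib

/-- The field of definition of the `n`-torsion of an elliptic curve `E` over `ℚ`: the subfield
`ℚ(E[n])` of the algebraic closure of `ℚ` generated by the affine coordinates of all the points
`P` of `E` over the algebraic closure such that `n • P = O`. (The point at infinity contributes
nothing.) -/
noncomputable def divisionField (E : WeierstrassCurve ℚ) (n : ℕ) :
    IntermediateField ℚ (AlgebraicClosure ℚ) :=
  open scoped Classical in
  IntermediateField.adjoin ℚ
    {z : AlgebraicClosure ℚ | ∃ (x y : AlgebraicClosure ℚ)
      (h : (E.baseChange (AlgebraicClosure ℚ)).toAffine.Nonsingular x y),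
      n • WeierstrassCurve.Affine.Point.some x y h = 0 ∧ (z = x ∨ z = y)}

/-- `D` is the (signed) squarefree part of the rational number `x`: it is a squarefree integer, and
`x` is `D` times the square of a nonzero rational number. -/
def IsSquarefreePart (D : ℤ) (x : ℚ) : Prop :=
  Squarefree D ∧ ∃ q : ℚ, q ≠ 0 ∧ x = D * q ^ 2

/-- Every nonzero rational number has exactly one squarefree part. -/
theorem existsUnique_isSquarefreePart {x : ℚ} (hx : x ≠ 0) : ∃! D : ℤ, IsSquarefreePart D x := by
  refine existsUnique_of_exists_of_unique ?_ ?_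
  · obtain ⟨a, b, hab, ha⟩ := Nat.sq_mul_squarefree (x.num * x.den).natAbs
    have hd : (x.den : ℚ) ≠ 0 := by exact_mod_cast x.den_nz
    have hn : x.num * x.den ≠ 0 :=
      mul_ne_zero (Rat.num_ne_zero.mpr hx) (by exact_mod_cast x.den_nz)
    have hb : b ≠ 0 := by
      rintro rfl
      apply hn
      rw [← Int.natAbs_eq_zero, ← hab]
      simp
    have hx' : x = ((x.num * x.den : ℤ) : ℚ) / (x.den : ℚ) ^ 2 := by
      nth_rewrite 1 [← Rat.num_div_den x]
      push_cast
      field_simp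
    have hb' : (b : ℚ) ≠ 0 := by exact_mod_cast hb
    rcases Int.natAbs_eq (x.num * x.den) with h | h
    · refine ⟨a, Int.squarefree_natCast.mpr ha, b / x.den, div_ne_zero hb' hd, ?_⟩
      refine hx'.trans ?_
      rw [h, ← hab]
      push_cast
      field_simp
    · refine ⟨-a, (Associated.refl (a : ℤ)).neg_left.squarefree_iff.mpr (Int.squarefree_natCast.mpr ha), b / x.den, div_ne_zero hb' hd, ?_⟩
      refine hx'.trans ?_
      rw [h, ← hab]
      push_cast
      field_simp
  · rintro D F ⟨hD, q, hq, h1⟩ ⟨hF, r, hr, h2⟩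
    have hD0 : D ≠ 0 := hD.ne_zero
    have hs : IsSquare ((D * F : ℤ) : ℚ) := by
      refine ⟨D * q / r, ?_⟩
      have : (D : ℚ) * q ^ 2 = F * r ^ 2 := h1.symm.trans h2
      push_cast
      field_simp
      linear_combination -this
    rw [Rat.isSquare_intCast_iff] at hs
    obtain ⟨s, hs⟩ := hs
    have hds : D ∣ s := hD.isRadical 2 s ⟨F, by rw [hs, sq]⟩
    obtain ⟨t, rfl⟩ := hds
    have hFt : F = D * (t * t) := by
      apply mul_left_cancel₀ hD0
      rw [hs]
      ring
    have ht : IsUnit t := hF t ⟨D, by rw [hFt]; ring⟩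
    rw [hFt, Int.isUnit_mul_self ht, mul_one]

/-! Write D = 3B and K = ℚ(E[m]). Since D is squarefree, m is prime to 3, so it suffices that E[3]
is defined over K: by Bézout (`TorsionDefinedOver.mul_of_coprime`) E[3m] is then defined over K. By
hypothesis this amounts to ζ₃ ∈ K, that is, √-3 ∈ K.

As m is even, K contains the roots eᵢ of the two-torsion polynomial, hence √Δ and √D = √(3B). It
remains to find √(-B) in K (`exists_sq_eq_neg_three`). The Weil pairing would give it through ζₘ ∈
K; here the square roots are built directly. The 4-torsion yields √-1 and the 8-torsion yields √2,
by halving points (`IsTwoTorsionRoots.exists_sq_eq_neg_one`, `IsTwoTorsionRoots.exists_sq_eq_two`).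

For odd n = 2k + 1, the n-torsion and the eᵢ yield √((-1)^k n) (`exists_sq_eq_neg_one_pow_mul`).
Multiply the values of the n-th division polynomial at e₁, e₂, e₃. Factoring over its roots a gives
n³ times a square, because ∏ (eᵢ - a) is minus a square in K; the recursion at a two-torsion point
gives (-1)^k times a square.

This needs the roots a to be abscissas of n-torsion points, which follows from the multiplication
formula `representsX_nsmul`. That formula is proved at generic points, turned into polynomial
identities by density, and extended to all points projectively. -/

/-! ### Degenerate elliptic divisibility sequences. -/

/-- With first parameter 0, the odd recursion loses the term with even indices, so the odd-indexed
values satisfy a closed recursion independent of `d`. -/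
lemma preNormEDS_zero_neg_sq {R : Type*} [CommRing R] (g d : R) (k : ℕ) :
    preNormEDS 0 (-g ^ 2) d (2 * k + 1) = (-1) ^ k * g ^ (k * (k + 1)) := by
  have hu (i : ℕ) : ((-1 : R) ^ i) ^ 2 = 1 := by
    rw [← pow_mul, mul_comm, pow_mul, neg_one_sq, one_pow]
  induction k using Nat.strong_induction_on with
  | _ k ih =>
    rw [preNormEDS_odd]
    obtain ⟨j, rfl | rfl⟩ := Nat.even_or_odd' k <;> rcases j with _ | j
    · simp
    · have h₁ := ih j (by lia)
      have h₂ := ih (j + 1) (by lia)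
      have hg : g ^ (j * (j + 1)) * (g ^ ((j + 1) * (j + 1 + 1))) ^ 3 =
          g ^ (2 * (j + 1) * (2 * (j + 1) + 1)) := by
        rw [← pow_mul, ← pow_add]
        congr 1
        ring
      push_cast at h₂ ⊢
      rw [if_pos (by simp), if_pos (by simp),
        show 2 * ((j : ℤ) + 1) - 1 = 2 * j + 1 by ring, h₁, h₂, ← hg, pow_mul (-1 : R) 2, neg_one_sq, one_pow,
        pow_succ (-1 : R)]
      linear_combination g ^ (j * (j + 1)) * (g ^ ((j + 1) * (j + 1 + 1))) ^ 3 *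
        (((-1) ^ j) ^ 2 + 1) * hu j
    · simp
    · have h₁ := ih (j + 1) (by lia)
      have h₂ := ih (j + 1 + 1) (by lia)
      have hg : g ^ ((j + 1 + 1) * (j + 1 + 1 + 1)) * (g ^ ((j + 1) * (j + 1 + 1))) ^ 3 =
          g ^ ((2 * (j + 1) + 1) * (2 * (j + 1) + 1 + 1)) := by
        rw [← pow_mul, ← pow_add]
        congr 1
        ring
      push_cast at h₁ h₂ ⊢
      rw [if_neg (by simp), if_neg (by simp),
        show 2 * ((j : ℤ) + 1) + 1 + 2 = 2 * (j + 1 + 1) + 1 by ring, h₁, h₂, ← hg,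
        pow_succ (-1 : R) (2 * (j + 1)), pow_mul (-1 : R) 2, neg_one_sq, one_pow,
        pow_succ (-1 : R) (j + 1)]
      linear_combination -g ^ ((j + 1 + 1) * (j + 1 + 1 + 1)) * (g ^ ((j + 1) * (j + 1 + 1))) ^ 3 *
        (((-1) ^ (j + 1)) ^ 2 + 1) * hu (j + 1)

namespace WeierstrassCurve

open Polynomial

/-! ### Addition and duplication formulas. -/

section AdditionFormulas

variable {F : Type*} [Field F] (W : WeierstrassCurve F)

/-- The denominator `2y + a₁x + a₃` of the slope of the tangent line at `(x, y)`. -/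
def tangentDenom (x y : F) : F :=
  2 * y + W.a₁ * x + W.a₃

lemma tangentDenom_negY (x y : F) :
    W.tangentDenom x (W.toAffine.negY x y) = -W.tangentDenom x y := by
  rw [tangentDenom, tangentDenom, Affine.negY]
  ring

variable {W}

lemma tangentDenom_sq {x y : F} (h : W.toAffine.Equation x y) :
    W.tangentDenom x y ^ 2 = 4 * x ^ 3 + W.b₂ * x ^ 2 + 2 * W.b₄ * x + W.b₆ := by
  rw [Affine.equation_iff] at h
  rw [tangentDenom, b₂, b₄, b₆]
  linear_combination 4 * h

lemma tangentDenom_ne_zero_iff {x y : F} :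
    W.tangentDenom x y ≠ 0 ↔ y ≠ W.toAffine.negY x y := by
  rw [tangentDenom, Affine.negY, ← sub_ne_zero (a := y)]
  ring_nf

variable [DecidableEq F]

lemma two_nsmul_of_tangentDenom_eq_zero {x y : F} (h : W.toAffine.Nonsingular x y)
    (h0 : W.tangentDenom x y = 0) : 2 • Affine.Point.some x y h = 0 := by
  rw [two_nsmul]
  exact Affine.Point.add_self_of_Y_eq (not_not.mp (tangentDenom_ne_zero_iff.not_right.mp h0))

variable [CharZero F]

/-- The sum and the difference of two affine points with different `x`-coordinates: the difference,
the sum and the product of their `x`-coordinates. -/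
lemma exists_add_sub_of_X_ne {x₁ y₁ x₂ y₂ : F} (h₁ : W.toAffine.Nonsingular x₁ y₁)
    (h₂ : W.toAffine.Nonsingular x₂ y₂) (hx : x₁ ≠ x₂) :
    ∃ (x₃ y₃ : F) (h₃ : W.toAffine.Nonsingular x₃ y₃) (x₄ y₄ : F)
      (h₄ : W.toAffine.Nonsingular x₄ y₄),
      Affine.Point.some x₁ y₁ h₁ + Affine.Point.some x₂ y₂ h₂ = Affine.Point.some x₃ y₃ h₃ ∧
      Affine.Point.some x₁ y₁ h₁ - Affine.Point.some x₂ y₂ h₂ = Affine.Point.some x₄ y₄ h₄ ∧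
      (x₄ - x₃) * (x₁ - x₂) ^ 2 = W.tangentDenom x₁ y₁ * W.tangentDenom x₂ y₂ ∧
      (x₃ + x₄) * (x₁ - x₂) ^ 2 = 2 * (x₁ + x₂) * (x₁ * x₂) + W.b₂ * (x₁ * x₂) +
        W.b₄ * (x₁ + x₂) + W.b₆ ∧
      x₃ * x₄ * (x₁ - x₂) ^ 2 = (x₁ * x₂) ^ 2 - W.b₄ * (x₁ * x₂) - W.b₆ * (x₁ + x₂) - W.b₈ := by
  have hx' : x₁ - x₂ ≠ 0 := sub_ne_zero.mpr hx
  have e₁ := tangentDenom_sq h₁.left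
  have e₂ := tangentDenom_sq h₂.left
  have hb := W.b_relation
  -- The ordinate `y` is left free so that the formula serves both the second point and its
  -- negative.
  have key {y : F} (ht : W.tangentDenom x₂ y ^ 2 = W.tangentDenom x₂ y₂ ^ 2) :
      4 * W.toAffine.addX x₁ x₂ (W.toAffine.slope x₁ x₂ y₁ y) * (x₁ - x₂) ^ 2 =
        (W.tangentDenom x₁ y₁ - W.tangentDenom x₂ y) ^ 2 -
          (W.b₂ + 4 * (x₁ + x₂)) * (x₁ - x₂) ^ 2 := by
    have hp : (y₁ - y) / (x₁ - x₂) * (x₁ - x₂) = y₁ - y := div_mul_cancel₀ _ hx'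
    rw [Affine.slope_of_X_ne hx, Affine.addX, tangentDenom, tangentDenom, b₂]
    linear_combination
      4 * ((y₁ - y) / (x₁ - x₂) * (x₁ - x₂) + (y₁ - y) + W.a₁ * (x₁ - x₂)) * hp
  have k₃ := key (y := y₂) rfl
  have k₄ := key (y := W.toAffine.negY x₂ y₂) (by rw [tangentDenom_negY, neg_sq])
  rw [tangentDenom_negY, sub_neg_eq_add] at k₄
  refine ⟨_, _, _, W.toAffine.addX x₁ x₂ (W.toAffine.slope x₁ x₂ y₁ (W.toAffine.negY x₂ y₂)),
    W.toAffine.addY x₁ x₂ y₁ (W.toAffine.slope x₁ x₂ y₁ (W.toAffine.negY x₂ y₂)),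
    Affine.nonsingular_add h₁ ((Affine.nonsingular_neg ..).mpr h₂) fun h ↦ hx h.1,
    Affine.Point.add_of_X_ne hx, ?_, ?_, ?_, ?_⟩
  · rw [sub_eq_add_neg, Affine.Point.neg_some, Affine.Point.add_of_X_ne hx]
  all_goals
    generalize W.toAffine.addX x₁ x₂ (W.toAffine.slope x₁ x₂ y₁ y₂) = x₃ at *
    generalize W.toAffine.addX x₁ x₂ (W.toAffine.slope x₁ x₂ y₁ (W.toAffine.negY x₂ y₂)) = x₄ at *
    generalize W.tangentDenom x₁ y₁ = t₁ at *
    generalize W.tangentDenom x₂ y₂ = t₂ at *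
  · linear_combination (k₄ - k₃) / 4
  · linear_combination (k₃ + k₄ + 2 * e₁ + 2 * e₂) / 4
  · apply mul_right_cancel₀ (pow_ne_zero 2 hx')
    -- The product of `k₃` and `k₄` is even in `t₁` and `t₂`, so the curve equation eliminates the
    -- ordinates.
    have hk : 16 * (x₃ * x₄ * (x₁ - x₂) ^ 2 * (x₁ - x₂) ^ 2) = (t₁ ^ 2 - t₂ ^ 2) ^ 2 -
        2 * (W.b₂ + 4 * (x₁ + x₂)) * (x₁ - x₂) ^ 2 * (t₁ ^ 2 + t₂ ^ 2) +
        ((W.b₂ + 4 * (x₁ + x₂)) * (x₁ - x₂) ^ 2) ^ 2 := by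
      linear_combination (4 * x₄ * (x₁ - x₂) ^ 2) * k₃ +
        ((t₁ - t₂) ^ 2 - (W.b₂ + 4 * (x₁ + x₂)) * (x₁ - x₂) ^ 2) * k₄
    rw [e₁, e₂] at hk
    linear_combination hk / 16 + (x₁ - x₂) ^ 2 / 4 * hb

/-- The duplication formula. -/
lemma exists_two_nsmul {x y : F} (h : W.toAffine.Nonsingular x y) (h0 : W.tangentDenom x y ≠ 0) :
    ∃ (x' y' : F) (h' : W.toAffine.Nonsingular x' y'),
      2 • Affine.Point.some x y h = Affine.Point.some x' y' h' ∧
      x' * W.tangentDenom x y ^ 2 = x ^ 4 - W.b₄ * x ^ 2 - 2 * W.b₆ * x - W.b₈ ∧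
      W.tangentDenom x' y' * W.tangentDenom x y ^ 3 = 2 * x ^ 6 + W.b₂ * x ^ 5 +
        5 * W.b₄ * x ^ 4 + 10 * W.b₆ * x ^ 3 + 10 * W.b₈ * x ^ 2 +
        (W.b₂ * W.b₈ - W.b₄ * W.b₆) * x + (W.b₄ * W.b₈ - W.b₆ ^ 2) := by
  have hy := tangentDenom_ne_zero_iff.mp h0
  have e := tangentDenom_sq h.left
  have hb := W.b_relation
  set ℓ := W.toAffine.slope x x y y with hℓ
  -- The right side is half the derivative of the two-torsion polynomial.
  have k : (2 * ℓ + W.a₁) * W.tangentDenom x y = 6 * x ^ 2 + W.b₂ * x + W.b₄ := by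
    have : y - W.toAffine.negY x y = W.tangentDenom x y := by rw [Affine.negY, tangentDenom]; ring
    rw [hℓ, Affine.slope_of_Y_ne rfl hy, this, add_mul, mul_assoc, div_mul_cancel₀ _ h0,
      tangentDenom, b₂, b₄]
    ring
  have kx : W.toAffine.addX x x ℓ * W.tangentDenom x y ^ 2 =
      x ^ 4 - W.b₄ * x ^ 2 - 2 * W.b₆ * x - W.b₈ := by
    have : 4 * W.toAffine.addX x x ℓ = (2 * ℓ + W.a₁) ^ 2 - W.b₂ - 8 * x := by
      rw [Affine.addX, b₂]; ring
    linear_combination W.tangentDenom x y ^ 2 / 4 * this +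
      ((2 * ℓ + W.a₁) * W.tangentDenom x y + (6 * x ^ 2 + W.b₂ * x + W.b₄)) / 4 * k -
      (W.b₂ + 8 * x) / 4 * e + hb / 4
  refine ⟨W.toAffine.addX x x ℓ, W.toAffine.addY x x y ℓ,
    Affine.nonsingular_add h h fun hxy ↦ hy hxy.2, ?_, kx, ?_⟩
  · rw [two_nsmul, Affine.Point.add_self_of_Y_ne hy]
  · have ky : W.tangentDenom (W.toAffine.addX x x ℓ) (W.toAffine.addY x x y ℓ) =
        -(2 * ℓ + W.a₁) * (W.toAffine.addX x x ℓ - x) - W.tangentDenom x y := by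
      rw [Affine.addY, Affine.negAddY, Affine.negY, tangentDenom, tangentDenom]
      ring
    rw [ky]
    generalize W.tangentDenom x y = t at *
    generalize W.toAffine.addX x x ℓ = x' at *
    linear_combination (-(x' - x) * t ^ 2) * k - (6 * x ^ 2 + W.b₂ * x + W.b₄) * kx +
      (x * (6 * x ^ 2 + W.b₂ * x + W.b₄) - t ^ 2 -
        (4 * x ^ 3 + W.b₂ * x ^ 2 + 2 * W.b₄ * x + W.b₆)) * e - x ^ 2 * hb

end AdditionFormulas

/-! ### Multiples of a generic point. -/

section GenericMultiples

variable {F : Type*} [Field F] (W : WeierstrassCurve F)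

/-- The values of the division polynomials at the point `(x, y)`. -/
noncomputable def divisionSequence (x y : F) (n : ℤ) : F :=
  normEDS (W.tangentDenom x y) (W.Ψ₃.eval x) (W.preΨ₄.eval x) n

lemma divisionSequence_zero (x y : F) : W.divisionSequence x y 0 = 0 :=
  normEDS_zero ..

lemma divisionSequence_one (x y : F) : W.divisionSequence x y 1 = 1 :=
  normEDS_one ..

lemma divisionSequence_two (x y : F) : W.divisionSequence x y 2 = W.tangentDenom x y :=
  normEDS_two ..

lemma divisionSequence_three (x y : F) : W.divisionSequence x y 3 = 3 * x ^ 4 + W.b₂ * x ^ 3 +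
    3 * W.b₄ * x ^ 2 + 3 * W.b₆ * x + W.b₈ := by
  simp [divisionSequence, Ψ₃]

lemma divisionSequence_four (x y : F) : W.divisionSequence x y 4 = (2 * x ^ 6 + W.b₂ * x ^ 5 +
    5 * W.b₄ * x ^ 4 + 10 * W.b₆ * x ^ 3 + 10 * W.b₈ * x ^ 2 +
    (W.b₂ * W.b₈ - W.b₄ * W.b₆) * x + (W.b₄ * W.b₈ - W.b₆ ^ 2)) * W.tangentDenom x y := by
  simp [divisionSequence, preΨ₄]

lemma divisionSequence_odd (x y : F) (m : ℤ) : W.divisionSequence x y (2 * m + 1) =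
    W.divisionSequence x y (m + 2) * W.divisionSequence x y m ^ 3 -
      W.divisionSequence x y (m - 1) * W.divisionSequence x y (m + 1) ^ 3 :=
  normEDS_odd ..

lemma divisionSequence_even (x y : F) (m : ℤ) :
    W.divisionSequence x y (2 * m) * W.tangentDenom x y =
      W.divisionSequence x y (m - 1) ^ 2 * W.divisionSequence x y m *
        W.divisionSequence x y (m + 2) - W.divisionSequence x y (m - 2) *
        W.divisionSequence x y m * W.divisionSequence x y (m + 1) ^ 2 :=
  normEDS_even ..

variable [DecidableEq F] {W}

/-- `k • P` is the affine point whose `x`-coordinate is given by the division polynomials. -/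
def IsMultipleGeneric {x y : F} (h : W.toAffine.Nonsingular x y) (k : ℕ) : Prop :=
  ∃ (x' y' : F) (h' : W.toAffine.Nonsingular x' y'),
    k • Affine.Point.some x y h = Affine.Point.some x' y' h' ∧
    x' * W.divisionSequence x y k ^ 2 = x * W.divisionSequence x y k ^ 2 -
      W.divisionSequence x y (k + 1) * W.divisionSequence x y (k - 1)

/-- The difference of the `x`-coordinates of consecutive multiples of `P`. -/
lemma X_sub_X_mul_divisionSequence_sq {x y xm ym xn yn : F} {h : W.toAffine.Nonsingular x y}
    {m : ℕ} {hm : W.toAffine.Nonsingular xm ym} {hn : W.toAffine.Nonsingular xn yn}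
    (Hm : IsMultipleGeneric h m) (Hn : IsMultipleGeneric h (m + 1))
    (em : m • Affine.Point.some x y h = Affine.Point.some xm ym hm)
    (en : (m + 1) • Affine.Point.some x y h = Affine.Point.some xn yn hn) :
    (xm - xn) * (W.divisionSequence x y m ^ 2 * W.divisionSequence x y (m + 1) ^ 2) =
      W.divisionSequence x y (2 * m + 1) := by
  obtain ⟨_, _, _, em', Hm⟩ := Hm
  obtain ⟨_, _, _, en', Hn⟩ := Hn
  obtain ⟨rfl, rfl⟩ := Affine.Point.some.inj (em.symm.trans em')
  obtain ⟨rfl, rfl⟩ := Affine.Point.some.inj (en.symm.trans en')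
  rw [divisionSequence_odd]
  push_cast at Hn
  rw [add_assoc, one_add_one_eq_two, add_sub_cancel_right] at Hn
  linear_combination W.divisionSequence x y (m + 1) ^ 2 * Hm - W.divisionSequence x y m ^ 2 * Hn

lemma isMultipleGeneric_one {x y : F} (h : W.toAffine.Nonsingular x y) :
    IsMultipleGeneric h 1 := by
  refine ⟨x, y, h, one_nsmul _, ?_⟩
  simp [divisionSequence_zero]

variable [CharZero F]

/-- The `y`-coordinates of the multiples of `P`. -/
lemma tangentDenom_mul_divisionSequence_pow {x y xm ym : F} {h : W.toAffine.Nonsingular x y}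
    {m : ℕ} {hm : W.toAffine.Nonsingular xm ym} (h2 : W.tangentDenom x y ≠ 0)
    (h0 : W.divisionSequence x y m ≠ 0)
    (h1 : W.divisionSequence x y (m + 1) ≠ 0) (h3 : W.divisionSequence x y (m + 2) ≠ 0)
    (Hl : IsMultipleGeneric h m) (Hm : IsMultipleGeneric h (m + 1))
    (Hn : IsMultipleGeneric h (m + 2))
    (em : (m + 1) • Affine.Point.some x y h = Affine.Point.some xm ym hm) :
    W.tangentDenom xm ym * W.divisionSequence x y (m + 1) ^ 4 =
      W.divisionSequence x y (2 * (m + 1)) := by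
  obtain ⟨_, _, _, em', Hm⟩ := Hm
  obtain ⟨rfl, rfl⟩ := Affine.Point.some.inj (em.symm.trans em')
  obtain ⟨xl, yl, hl, el, Hl⟩ := Hl
  obtain ⟨xn, yn, hn, en, Hn⟩ := Hn
  push_cast at Hm Hn
  rw [add_assoc, one_add_one_eq_two, add_sub_cancel_right] at Hm
  rw [show (m : ℤ) + 2 - 1 = m + 1 by ring, show (m : ℤ) + 2 + 1 = m + 3 by ring] at Hn
  have hx : xm ≠ x := by
    rintro rfl
    exact mul_ne_zero h3 h0 (by linear_combination Hm)
  -- The neighbours mP and (m + 2)P are (m + 1)P ∓ P, so the difference of their abscissas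
  -- determines the ordinate of (m + 1)P.
  obtain ⟨x₃, y₃, h₃, x₄, y₄, h₄, e₃, e₄, k, -, -⟩ := exists_add_sub_of_X_ne hm h hx
  rw [← em, ← succ_nsmul, en] at e₃
  rw [← em, succ_nsmul, add_sub_cancel_right, el] at e₄
  obtain ⟨rfl, rfl⟩ := Affine.Point.some.inj e₃
  obtain ⟨rfl, rfl⟩ := Affine.Point.some.inj e₄
  apply mul_right_cancel₀ h2
  have hr := W.divisionSequence_even x y (m + 1)
  rw [show (m : ℤ) + 1 - 1 = m by ring, show (m : ℤ) + 1 - 2 = m - 1 by ring,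
    show (m : ℤ) + 1 + 2 = m + 3 by ring, show (m : ℤ) + 1 + 1 = m + 2 by ring] at hr
  rw [hr]
  have hd : ((xm - x) * W.divisionSequence x y (m + 1) ^ 2) ^ 2 =
      (W.divisionSequence x y (m + 2) * W.divisionSequence x y m) ^ 2 := by
    rw [sub_mul, Hm]
    ring
  linear_combination -W.divisionSequence x y (m + 1) ^ 4 * k + (xl - xn) * hd +
    W.divisionSequence x y (m + 2) ^ 2 * Hl - W.divisionSequence x y m ^ 2 * Hn

/-- The formula `(x(A) - x(A + B)) (x(A - B) - x(A)) (x(A) - x(B))² = (x(B) - x(2A)) ψ₂(A)²`. -/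
lemma X_sub_mul_X_sub_mul_sq {x₁ y₁ x₂ y₂ x₃ y₃ x₄ y₄ x₅ y₅ : F}
    {h₁ : W.toAffine.Nonsingular x₁ y₁} {h₂ : W.toAffine.Nonsingular x₂ y₂}
    {h₃ : W.toAffine.Nonsingular x₃ y₃} {h₄ : W.toAffine.Nonsingular x₄ y₄}
    {h₅ : W.toAffine.Nonsingular x₅ y₅} (hx : x₁ ≠ x₂) (ht : W.tangentDenom x₁ y₁ ≠ 0)
    (e₃ : Affine.Point.some x₁ y₁ h₁ + Affine.Point.some x₂ y₂ h₂ = Affine.Point.some x₃ y₃ h₃)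
    (e₄ : Affine.Point.some x₁ y₁ h₁ - Affine.Point.some x₂ y₂ h₂ = Affine.Point.some x₄ y₄ h₄)
    (e₅ : 2 • Affine.Point.some x₁ y₁ h₁ = Affine.Point.some x₅ y₅ h₅) :
    (x₁ - x₃) * (x₄ - x₁) * (x₁ - x₂) ^ 2 = (x₂ - x₅) * W.tangentDenom x₁ y₁ ^ 2 := by
  obtain ⟨_, _, _, _, _, _, e₃', e₄', -, ks, kp⟩ := exists_add_sub_of_X_ne h₁ h₂ hx
  obtain ⟨rfl, rfl⟩ := Affine.Point.some.inj (e₃.symm.trans e₃')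
  obtain ⟨rfl, rfl⟩ := Affine.Point.some.inj (e₄.symm.trans e₄')
  obtain ⟨_, _, _, e₅', k₅, -⟩ := exists_two_nsmul h₁ ht
  obtain ⟨rfl, rfl⟩ := Affine.Point.some.inj (e₅.symm.trans e₅')
  have e := tangentDenom_sq h₁.left
  linear_combination x₁ * ks - kp + k₅ - x₂ * e

lemma isMultipleGeneric_two {x y : F} (h : W.toAffine.Nonsingular x y)
    (h2 : W.tangentDenom x y ≠ 0) : IsMultipleGeneric h 2 := by
  obtain ⟨x', y', h', e', k, -⟩ := exists_two_nsmul h h2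
  refine ⟨x', y', h', e', ?_⟩
  have e := tangentDenom_sq h.left
  norm_num only [divisionSequence_one, divisionSequence_two, divisionSequence_three, Nat.cast_ofNat]
  linear_combination k - x * e

lemma tangentDenom_two_nsmul {x y x' y' : F} {h : W.toAffine.Nonsingular x y}
    {h' : W.toAffine.Nonsingular x' y'} (h2 : W.tangentDenom x y ≠ 0)
    (e : 2 • Affine.Point.some x y h = Affine.Point.some x' y' h') :
    W.tangentDenom x' y' * W.divisionSequence x y 2 ^ 4 = W.divisionSequence x y 4 := by
  obtain ⟨_, _, _, e', -, k⟩ := exists_two_nsmul h h2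
  obtain ⟨rfl, rfl⟩ := Affine.Point.some.inj (e.symm.trans e')
  rw [divisionSequence_two, divisionSequence_four, ← k]
  ring

/-- `X_sub_mul_X_sub_mul_sq` with A = (m + 1)P and B = P expresses x(P) - x(2A) through differences
of consecutive multiples, which are known by the odd recursion. -/
lemma isMultipleGeneric_two_mul {x y : F} {h : W.toAffine.Nonsingular x y} {m : ℕ}
    (h2 : W.tangentDenom x y ≠ 0) (h0 : W.divisionSequence x y m ≠ 0)
    (h1 : W.divisionSequence x y (m + 1) ≠ 0) (h3 : W.divisionSequence x y (m + 2) ≠ 0)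
    (h4 : W.divisionSequence x y (2 * (m + 1)) ≠ 0)
    (Hl : IsMultipleGeneric h m) (Hm : IsMultipleGeneric h (m + 1))
    (Hn : IsMultipleGeneric h (m + 2)) : IsMultipleGeneric h (2 * (m + 1)) := by
  obtain ⟨xm, ym, hm, em, Xm⟩ := id Hm
  obtain ⟨xl, yl, hl, el, -⟩ := id Hl
  obtain ⟨xn, yn, hn, en, -⟩ := id Hn
  push_cast at Xm
  rw [add_assoc, one_add_one_eq_two, add_sub_cancel_right] at Xm
  have hx : xm ≠ x := by
    rintro rfl
    exact mul_ne_zero h3 h0 (by linear_combination Xm)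
  have E := tangentDenom_mul_divisionSequence_pow h2 h0 h1 h3 Hl Hm Hn em
  have O₁ := X_sub_X_mul_divisionSequence_sq Hl Hm el em
  have O₂ := X_sub_X_mul_divisionSequence_sq Hm Hn em en
  have ht : W.tangentDenom xm ym ≠ 0 := by
    intro h0
    rw [h0, zero_mul] at E
    exact h4 E.symm
  have e₃ : Affine.Point.some xm ym hm + Affine.Point.some x y h =
      Affine.Point.some xn yn hn := by
    rw [← em, ← succ_nsmul, en]
  have e₄ : Affine.Point.some xm ym hm - Affine.Point.some x y h =
      Affine.Point.some xl yl hl := by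
    rw [← em, succ_nsmul, add_sub_cancel_right, el]
  obtain ⟨x₅, y₅, h₅, e₅, -⟩ := exists_two_nsmul hm ht
  have k := X_sub_mul_X_sub_mul_sq hx ht e₃ e₄ e₅
  refine ⟨x₅, y₅, h₅, by rw [mul_comm, mul_nsmul, em, e₅], ?_⟩
  push_cast at O₂ ⊢
  rw [add_assoc (m : ℤ), one_add_one_eq_two] at O₂
  rw [show 2 * ((m : ℤ) + 1) - 1 = 2 * m + 1 by ring, ← O₁, ← O₂, ← E]
  have hd : ((xm - x) * W.divisionSequence x y (m + 1) ^ 2) ^ 2 =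
      (W.divisionSequence x y (m + 2) * W.divisionSequence x y m) ^ 2 := by
    rw [sub_mul, Xm]
    ring
  linear_combination W.divisionSequence x y (m + 1) ^ 8 * k -
    (xm - xn) * (xl - xm) * W.divisionSequence x y (m + 1) ^ 4 * hd

/-- The points (m + 1)P and mP have difference P, so the formula for x(A - B) - x(A + B) gives the
abscissa of their sum. -/
lemma isMultipleGeneric_two_mul_add_one {x y xm ym xn yn : F} {h : W.toAffine.Nonsingular x y}
    {m : ℕ} {hm : W.toAffine.Nonsingular xm ym} {hn : W.toAffine.Nonsingular xn yn}
    (h1 : W.divisionSequence x y (2 * m + 1) ≠ 0)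
    (Hm : IsMultipleGeneric h m) (Hn : IsMultipleGeneric h (m + 1))
    (em : m • Affine.Point.some x y h = Affine.Point.some xm ym hm)
    (en : (m + 1) • Affine.Point.some x y h = Affine.Point.some xn yn hn)
    (Em : W.tangentDenom xm ym * W.divisionSequence x y m ^ 4 =
      W.divisionSequence x y (2 * m))
    (En : W.tangentDenom xn yn * W.divisionSequence x y (m + 1) ^ 4 =
      W.divisionSequence x y (2 * (m + 1))) : IsMultipleGeneric h (2 * m + 1) := by
  have O := X_sub_X_mul_divisionSequence_sq Hm Hn em en
  have hx : xn ≠ xm := by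
    rintro rfl
    rw [sub_self, zero_mul] at O
    exact h1 O.symm
  obtain ⟨x₃, y₃, h₃, x₄, y₄, h₄, e₃, e₄, k, -, -⟩ := exists_add_sub_of_X_ne hn hm hx
  rw [← em, ← en, succ_nsmul, add_sub_cancel_left] at e₄
  rw [← em, ← en, ← add_nsmul] at e₃
  obtain ⟨rfl, rfl⟩ := Affine.Point.some.inj e₄
  refine ⟨x₃, y₃, h₃, by rw [← e₃]; congr 1; ring, ?_⟩
  push_cast
  rw [show 2 * (m : ℤ) + 1 + 1 = 2 * (m + 1) by ring, add_sub_cancel_right, ← O, ← Em, ← En]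
  linear_combination -W.divisionSequence x y m ^ 4 * W.divisionSequence x y (m + 1) ^ 4 * k

/-- If the first values of the division polynomials at `P` do not vanish, then the multiples of `P`
are given by the division polynomials. -/
theorem isMultipleGeneric_of_ne_zero {x y : F} (h : W.toAffine.Nonsingular x y) {N : ℕ}
    (hN : ∀ k : ℕ, 1 ≤ k → k ≤ N + 1 → W.divisionSequence x y k ≠ 0) (k : ℕ) (hk : 1 ≤ k)
    (hkN : k ≤ N) : IsMultipleGeneric h k := by
  have h2 : W.tangentDenom x y ≠ 0 := by
    rw [← divisionSequence_two]
    exact hN 2 one_le_two (by lia)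
  induction k using Nat.strong_induction_on with
  | _ k ih =>
    replace ih : ∀ i < k, 1 ≤ i → IsMultipleGeneric h i := fun i hi h1 ↦ ih i hi h1 (by lia)
    obtain rfl | rfl | hk3 : k = 1 ∨ k = 2 ∨ 3 ≤ k := by lia
    · exact isMultipleGeneric_one h
    · exact isMultipleGeneric_two h h2
    -- The case j = 2 is separate: for k = 3 the general formula would already need 3P.
    have E {j : ℕ} (hj : 1 ≤ j) (hj1 : j ≤ 2 ∨ j + 1 < k) {xj yj : F}
        {hj' : W.toAffine.Nonsingular xj yj}
        (ej : j • Affine.Point.some x y h = Affine.Point.some xj yj hj') :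
        W.tangentDenom xj yj * W.divisionSequence x y j ^ 4 =
          W.divisionSequence x y (2 * j) := by
      obtain rfl | rfl | hj2 : j = 1 ∨ j = 2 ∨ 2 < j := by lia
      · rw [one_nsmul] at ej
        obtain ⟨rfl, rfl⟩ := Affine.Point.some.inj ej
        simp [divisionSequence_one, divisionSequence_two]
      · exact tangentDenom_two_nsmul h2 ej
      · obtain ⟨j, rfl⟩ := Nat.exists_eq_add_of_le' hj
        push_cast
        refine tangentDenom_mul_divisionSequence_pow h2 ?_ ?_ ?_ (ih _ ?_ ?_) (ih _ ?_ ?_)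
          (ih _ ?_ ?_) ej
        · exact hN j (by lia) (by lia)
        · exact_mod_cast hN (j + 1) (by lia) (by lia)
        · exact_mod_cast hN (j + 2) (by lia) (by lia)
        all_goals lia
    obtain ⟨m, rfl | rfl⟩ := Nat.even_or_odd' k
    · obtain ⟨m, rfl⟩ := Nat.exists_eq_add_of_le' (show 1 ≤ m by lia)
      refine isMultipleGeneric_two_mul h2 ?_ ?_ ?_ ?_ (ih _ ?_ ?_) (ih _ ?_ ?_) (ih _ ?_ ?_)
      · exact hN m (by lia) (by lia)
      · exact_mod_cast hN (m + 1) (by lia) (by lia)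
      · exact_mod_cast hN (m + 2) (by lia) (by lia)
      · exact_mod_cast hN (2 * (m + 1)) (by lia) (by lia)
      all_goals lia
    · have Hm := ih m (by lia) (by lia)
      have Hn := ih (m + 1) (by lia) (by lia)
      obtain ⟨xm, ym, hm, em, -⟩ := id Hm
      obtain ⟨xn, yn, hn, en, -⟩ := id Hn
      refine isMultipleGeneric_two_mul_add_one ?_ Hm Hn em en (E (by lia) (by lia) em) ?_
      · exact_mod_cast hN (2 * m + 1) (by lia) (by lia)
      · exact_mod_cast E (by lia) (by lia) en

end GenericMultiples

/-! ### Polynomial identities by density. -/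

section MultiplicationFormula

variable {F : Type*} [Field F] {W : WeierstrassCurve F}

lemma eval_Ψ₂Sq {x y : F} (h : W.toAffine.Equation x y) :
    W.Ψ₂Sq.eval x = W.tangentDenom x y ^ 2 := by
  rw [tangentDenom_sq h, Ψ₂Sq]
  simp

lemma divisionSequence_eq {x y : F} (h : W.toAffine.Equation x y) (n : ℤ) :
    W.divisionSequence x y n =
      (W.preΨ n).eval x * if Even n then W.tangentDenom x y else 1 := by
  rw [divisionSequence, normEDS, preΨ, ← coe_evalRingHom, map_preNormEDS]
  simp only [coe_evalRingHom, eval_pow, eval_Ψ₂Sq h, ← pow_mul, Nat.reduceMul]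

lemma eval_ΨSq {x y : F} (h : W.toAffine.Equation x y) (n : ℤ) :
    (W.ΨSq n).eval x = W.divisionSequence x y n ^ 2 := by
  rw [divisionSequence_eq h, ΨSq]
  split_ifs <;> simp [eval_Ψ₂Sq h, mul_pow]

lemma eval_Φ {x y : F} (h : W.toAffine.Equation x y) (n : ℤ) :
    (W.Φ n).eval x = x * W.divisionSequence x y n ^ 2 -
      W.divisionSequence x y (n + 1) * W.divisionSequence x y (n - 1) := by
  rw [← eval_ΨSq h, divisionSequence_eq h, divisionSequence_eq h, WeierstrassCurve.Φ]
  simp only [Int.even_add_one, Int.even_sub_one]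
  split_ifs <;> simp [eval_Ψ₂Sq h]
  ring

variable [IsAlgClosed F]

variable (W) in
lemma exists_equation (x : F) : ∃ y, W.toAffine.Equation x y := by
  have hd : (X ^ 2 + C (W.a₁ * x + W.a₃) * X -
      C (x ^ 3 + W.a₂ * x ^ 2 + W.a₄ * x + W.a₆) : F[X]).degree ≠ 0 := by
    have : (X ^ 2 + C (W.a₁ * x + W.a₃) * X -
      C (x ^ 3 + W.a₂ * x ^ 2 + W.a₄ * x + W.a₆) : F[X]).degree = 2 := by compute_degree!
    rw [this]
    decide
  obtain ⟨y, hy⟩ := IsAlgClosed.exists_root _ hd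
  refine ⟨y, (Affine.equation_iff ..).mpr ?_⟩
  simp only [IsRoot, eval_sub, eval_add, eval_mul, eval_pow, eval_X, eval_C] at hy
  linear_combination hy

variable (W) in
lemma exists_nonsingular [W.IsElliptic] (x : F) : ∃ y, W.toAffine.Nonsingular x y := by
  obtain ⟨y, hy⟩ := W.exists_equation x
  exact ⟨y, Affine.equation_iff_nonsingular.mp hy⟩

variable [CharZero F] [W.IsElliptic]

/-- Two polynomials agree if they agree at the `x`-coordinates of all points at which the first few
division polynomials do not vanish. -/
lemma polynomial_ext_of_divisionSequence_ne_zero (N : ℕ) {p q : F[X]}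
    (H : ∀ x y, W.toAffine.Nonsingular x y →
      (∀ k : ℕ, 1 ≤ k → k ≤ N → W.divisionSequence x y k ≠ 0) → p.eval x = q.eval x) : p = q := by
  -- This nonzero polynomial vanishes at all excluded abscissas, so its product with p - q vanishes
  -- identically.
  have hG : W.Ψ₂Sq * ∏ k ∈ Finset.Icc 1 N, W.preΨ' k ≠ 0 := by
    refine mul_ne_zero (W.Ψ₂Sq_ne_zero (by norm_num)) (Finset.prod_ne_zero_iff.mpr fun k hk ↦ ?_)
    exact W.preΨ'_ne_zero (Nat.cast_ne_zero.mpr (by grind))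
  refine sub_eq_zero.mp ((mul_eq_zero.mp ?_).resolve_right hG)
  refine Polynomial.funext fun x ↦ ?_
  obtain ⟨y, h⟩ := W.exists_nonsingular x
  rw [eval_mul, eval_sub, eval_zero, mul_eq_zero, sub_eq_zero, or_iff_not_imp_right]
  intro hx
  refine H x y h fun k hk hkN h0 ↦ hx ?_
  rw [eval_mul, eval_Ψ₂Sq h.left, eval_prod]
  rw [divisionSequence_eq h.left, mul_eq_zero] at h0
  obtain h0 | h0 := h0
  · rw [Finset.prod_eq_zero (Finset.mem_Icc.mpr ⟨hk, hkN⟩) (by rwa [preΨ_ofNat] at h0), mul_zero]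
  · split_ifs at h0
    · rw [h0]
      simp
    · exact absurd h0 one_ne_zero

omit [IsAlgClosed F] [W.IsElliptic] in
lemma tangentDenom_mul_of_ne_zero [DecidableEq F] {x y : F} (h : W.toAffine.Nonsingular x y) {N : ℕ}
    (hN : ∀ k : ℕ, 1 ≤ k → k ≤ N + 1 → W.divisionSequence x y k ≠ 0) {m : ℕ} (hm : 1 ≤ m)
    (hmN : m + 1 ≤ N) {xm ym : F} {hm' : W.toAffine.Nonsingular xm ym}
    (em : m • Affine.Point.some x y h = Affine.Point.some xm ym hm') :
    W.tangentDenom xm ym * W.divisionSequence x y m ^ 4 = W.divisionSequence x y (2 * m) := by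
  obtain rfl | hm2 := hm.eq_or_lt
  · rw [one_nsmul] at em
    obtain ⟨rfl, rfl⟩ := Affine.Point.some.inj em
    simp [divisionSequence_one, divisionSequence_two]
  have H := isMultipleGeneric_of_ne_zero h hN
  obtain ⟨m, rfl⟩ := Nat.exists_eq_add_of_le' hm
  push_cast
  refine tangentDenom_mul_divisionSequence_pow ?_ ?_ ?_ ?_ (H _ ?_ ?_) (H _ ?_ ?_) (H _ ?_ ?_) em
  · rw [← divisionSequence_two]
    exact hN 2 (by lia) (by lia)
  · exact hN m (by lia) (by lia)
  · exact_mod_cast hN (m + 1) (by lia) (by lia)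
  · exact_mod_cast hN (m + 2) (by lia) (by lia)
  all_goals lia

/-- At a generic point this is the square of ψ₂ₘ = ψ₂(mP) ψₘ⁴, with ψ₂(mP)² expanded by the curve
equation. -/
lemma ΨSq_two_mul {m : ℕ} (hm : 1 ≤ m) : W.ΨSq (2 * m) = W.ΨSq m * (4 * W.Φ m ^ 3 +
    C W.b₂ * W.Φ m ^ 2 * W.ΨSq m + 2 * C W.b₄ * W.Φ m * W.ΨSq m ^ 2 + C W.b₆ * W.ΨSq m ^ 3) := by
  classical
  refine polynomial_ext_of_divisionSequence_ne_zero (W := W) (m + 2) fun x y h hN ↦ ?_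
  obtain ⟨xm, ym, hm', em, X⟩ := isMultipleGeneric_of_ne_zero h hN m hm (by lia)
  have E := tangentDenom_mul_of_ne_zero h hN hm le_rfl em
  simp only [eval_add, eval_mul, eval_pow, eval_C, eval_ofNat, eval_ΨSq h.left, eval_Φ h.left]
  rw [← X, ← E, mul_pow, tangentDenom_sq hm'.left]
  ring

lemma Φ_two_mul {m : ℕ} (hm : 1 ≤ m) : W.Φ (2 * m) = W.Φ m ^ 4 -
    C W.b₄ * W.Φ m ^ 2 * W.ΨSq m ^ 2 - 2 * C W.b₆ * W.Φ m * W.ΨSq m ^ 3 -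
    C W.b₈ * W.ΨSq m ^ 4 := by
  classical
  refine polynomial_ext_of_divisionSequence_ne_zero (W := W) (2 * m + 2) fun x y h hN ↦ ?_
  obtain ⟨xm, ym, hm', em, Xm⟩ := isMultipleGeneric_of_ne_zero h hN m hm (by lia)
  obtain ⟨xn, yn, hn', en, Xn⟩ := isMultipleGeneric_of_ne_zero h hN (2 * m) (by lia) (by lia)
  have E := tangentDenom_mul_of_ne_zero h hN hm (by lia) em
  have h0 : W.tangentDenom xm ym ≠ 0 := by
    intro h0
    rw [h0, zero_mul] at E
    exact hN (2 * m) (by lia) (by lia) (by exact_mod_cast E.symm)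
  obtain ⟨x', y', h', e', k, -⟩ := exists_two_nsmul hm' h0
  rw [← em, ← mul_nsmul', en] at e'
  obtain ⟨rfl, rfl⟩ := Affine.Point.some.inj e'
  simp only [eval_sub, eval_mul, eval_pow, eval_C, eval_ofNat, eval_ΨSq h.left, eval_Φ h.left]
  push_cast at Xn
  rw [← Xm, ← Xn, ← E]
  linear_combination W.divisionSequence x y m ^ 8 * k

lemma ΨSq_two_mul_add_one (m : ℕ) : W.ΨSq (2 * m + 1) =
    (W.Φ m * W.ΨSq (m + 1) - W.Φ (m + 1) * W.ΨSq m) ^ 2 := by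
  refine polynomial_ext_of_divisionSequence_ne_zero (W := W) 0 fun x y h _ ↦ ?_
  simp only [eval_sub, eval_mul, eval_pow, eval_ΨSq h.left, eval_Φ h.left, divisionSequence_odd,
    add_assoc, one_add_one_eq_two, add_sub_cancel_right]
  ring

/-- The left side is the homogenised sum of the abscissas of (2m + 1)P and P, which are the sum and
the difference of (m + 1)P and mP. -/
lemma Φ_two_mul_add_one {m : ℕ} (hm : 1 ≤ m) : W.Φ (2 * m + 1) + X * W.ΨSq (2 * m + 1) =
    2 * (W.Φ m * W.ΨSq (m + 1) + W.Φ (m + 1) * W.ΨSq m) * (W.Φ m * W.Φ (m + 1)) +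
    C W.b₂ * (W.Φ m * W.Φ (m + 1)) * (W.ΨSq m * W.ΨSq (m + 1)) +
    C W.b₄ * (W.Φ m * W.ΨSq (m + 1) + W.Φ (m + 1) * W.ΨSq m) * (W.ΨSq m * W.ΨSq (m + 1)) +
    C W.b₆ * (W.ΨSq m * W.ΨSq (m + 1)) ^ 2 := by
  classical
  refine polynomial_ext_of_divisionSequence_ne_zero (W := W) (2 * m + 2) fun x y h hN ↦ ?_
  have Hm := isMultipleGeneric_of_ne_zero h hN m hm (by lia)
  have Hn := isMultipleGeneric_of_ne_zero h hN (m + 1) (by lia) (by lia)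
  obtain ⟨xm, ym, hm', em, Xm⟩ := id Hm
  obtain ⟨xn, yn, hn', en, Xn⟩ := id Hn
  obtain ⟨xp, yp, hp', ep, Xp⟩ := isMultipleGeneric_of_ne_zero h hN (2 * m + 1) (by lia) (by lia)
  have O := X_sub_X_mul_divisionSequence_sq Hm Hn em en
  have hx : xn ≠ xm := by
    rintro rfl
    rw [sub_self, zero_mul] at O
    exact hN (2 * m + 1) (by lia) (by lia) (by exact_mod_cast O.symm)
  obtain ⟨x₃, y₃, h₃, x₄, y₄, h₄, e₃, e₄, -, k, -⟩ := exists_add_sub_of_X_ne hn' hm' hx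
  rw [← em, ← en, succ_nsmul, add_sub_cancel_left] at e₄
  rw [← em, ← en, ← add_nsmul, show m + 1 + m = 2 * m + 1 by ring, ep] at e₃
  obtain ⟨rfl, rfl⟩ := Affine.Point.some.inj e₄
  obtain ⟨rfl, rfl⟩ := Affine.Point.some.inj e₃
  simp only [eval_add, eval_mul, eval_pow, eval_C, eval_ofNat, eval_X, eval_ΨSq h.left,
    eval_Φ h.left]
  push_cast at Xn Xp
  rw [← Xm, ← Xn, ← Xp, ← O]
  linear_combination W.divisionSequence x y m ^ 4 * W.divisionSequence x y (m + 1) ^ 4 * k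

end MultiplicationFormula

/-! ### The multiplication formula for all points. -/

section MultiplicationFormula

variable {F : Type*} [Field F] {W : WeierstrassCurve F}

/-- `(u : v)` is the `x`-coordinate of `Q` as a point of the projective line. -/
def RepresentsX (u v : F) (Q : W.toAffine.Point) : Prop :=
  (Q = 0 ∧ v = 0 ∧ u ≠ 0) ∨ ∃ (x y : F) (h : W.toAffine.Nonsingular x y),
    Q = Affine.Point.some x y h ∧ v ≠ 0 ∧ u = x * v

variable [DecidableEq F] [CharZero F]

/-- The point is that projective duplication has no base point: at a two-torsion point the
denominator vanishes, but nonsingularity keeps the numerator nonzero. -/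
lemma RepresentsX.two_nsmul {u v : F} {Q : W.toAffine.Point} (H : RepresentsX u v Q) :
    RepresentsX (u ^ 4 - W.b₄ * u ^ 2 * v ^ 2 - 2 * W.b₆ * u * v ^ 3 - W.b₈ * v ^ 4)
      (v * (4 * u ^ 3 + W.b₂ * u ^ 2 * v + 2 * W.b₄ * u * v ^ 2 + W.b₆ * v ^ 3)) (2 • Q) := by
  obtain ⟨rfl, rfl, hu⟩ | ⟨x, y, h, rfl, hv, rfl⟩ := H
  · exact .inl ⟨nsmul_zero _, by ring, by simpa using hu⟩
  have e := tangentDenom_sq h.left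
  by_cases ht : W.tangentDenom x y = 0
  · refine .inl ⟨two_nsmul_of_tangentDenom_eq_zero h ht, ?_, ?_⟩
    · rw [ht] at e
      linear_combination -v ^ 4 * e
    · have hN : 6 * x ^ 2 + W.b₂ * x + W.b₄ ≠ 0 := by
        obtain hN | hN := ((Affine.nonsingular_iff' ..).mp h).2
        · intro h0
          apply hN
          rw [b₂, b₄] at h0
          rw [tangentDenom] at ht
          linear_combination W.a₁ / 2 * ht - h0 / 2
        · exact absurd (by rw [← ht, tangentDenom]) hN
      have hv' : v ^ 4 * (6 * x ^ 2 + W.b₂ * x + W.b₄) ^ 2 ≠ 0 :=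
        mul_ne_zero (pow_ne_zero 4 hv) (pow_ne_zero 2 hN)
      intro h0
      apply hv'
      rw [ht] at e
      linear_combination 4 * h0 - v ^ 4 * (8 * x + W.b₂) * e + v ^ 4 * W.b_relation
  · obtain ⟨x', y', h', e', k, -⟩ := exists_two_nsmul h ht
    have hd : v * (4 * (x * v) ^ 3 + W.b₂ * (x * v) ^ 2 * v + 2 * W.b₄ * (x * v) * v ^ 2 +
        W.b₆ * v ^ 3) = v ^ 4 * W.tangentDenom x y ^ 2 := by
      rw [e]
      ring
    refine .inr ⟨x', y', h', e', ?_, ?_⟩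
    · rw [hd]
      exact mul_ne_zero (pow_ne_zero 4 hv) (pow_ne_zero 2 ht)
    · rw [hd]
      linear_combination -v ^ 4 * k

/-- Differential addition. That A - B is affine excludes A = B; if A = -B, then 2A = A - B is
nonzero, so A is not two-torsion and w ≠ 0. -/
lemma RepresentsX.add {u₁ v₁ u₂ v₂ x y z w : F} {A B : W.toAffine.Point}
    {h : W.toAffine.Nonsingular x y} (H₁ : RepresentsX u₁ v₁ A) (H₂ : RepresentsX u₂ v₂ B)
    (e : A - B = Affine.Point.some x y h)
    (hz : z = (u₂ * v₁ - u₁ * v₂) ^ 2)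
    (hw : w + x * z = 2 * (u₂ * v₁ + u₁ * v₂) * (u₂ * u₁) + W.b₂ * (u₂ * u₁) * (v₂ * v₁) +
      W.b₄ * (u₂ * v₁ + u₁ * v₂) * (v₂ * v₁) + W.b₆ * (v₂ * v₁) ^ 2) :
    RepresentsX w z (A + B) := by
  obtain ⟨rfl, rfl, hu₁⟩ | ⟨x₁, y₁, h₁, rfl, hv₁, rfl⟩ := H₁ <;>
  obtain ⟨rfl, rfl, hu₂⟩ | ⟨x₂, y₂, h₂, rfl, hv₂, rfl⟩ := H₂
  · simp at e
  · rw [zero_sub, Affine.Point.neg_some] at e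
    obtain ⟨rfl, -⟩ := Affine.Point.some.inj e
    refine .inr ⟨x₂, y₂, h₂, zero_add _, ?_, ?_⟩
    · rw [hz]
      simp [hu₁, hv₂]
    · linear_combination hw - 2 * x₂ * hz
  · rw [sub_zero] at e
    obtain ⟨rfl, -⟩ := Affine.Point.some.inj e
    refine .inr ⟨x₁, y₁, h₁, add_zero _, ?_, ?_⟩
    · rw [hz]
      simp [hu₂, hv₁]
    · linear_combination hw - 2 * x₁ * hz
  · by_cases hx : x₁ = x₂
    · obtain hAB | hAB := (Affine.Point.X_eq_iff (h₁ := h₁) (h₂ := h₂)).mp hx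
      · rw [hAB, sub_self] at e
        exact absurd e.symm (Affine.Point.some_ne_zero h)
      · have ht : W.tangentDenom x₁ y₁ ≠ 0 := by
          intro ht
          have h2 := two_nsmul_of_tangentDenom_eq_zero h₁ ht
          rw [_root_.two_nsmul] at h2
          nth_rewrite 2 [hAB] at h2
          rw [← sub_eq_add_neg, e] at h2
          exact Affine.Point.some_ne_zero h h2
        have e₁ := tangentDenom_sq h₁.left
        subst hx
        obtain rfl : z = 0 := by
          rw [hz]
          ring
        refine .inl ⟨by rw [hAB, neg_add_cancel], rfl, ?_⟩
        have : w = (v₁ * v₂ * W.tangentDenom x₁ y₁) ^ 2 := by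
          rw [mul_pow, e₁]
          linear_combination hw
        rw [this]
        exact pow_ne_zero 2 (mul_ne_zero (mul_ne_zero hv₁ hv₂) ht)
    · obtain ⟨x₃, y₃, h₃, x₄, y₄, h₄, e₃, e₄, -, k, -⟩ := exists_add_sub_of_X_ne h₁ h₂ hx
      obtain ⟨rfl, rfl⟩ := Affine.Point.some.inj (e₄.symm.trans e)
      have hz' : z = (v₁ * v₂) ^ 2 * (x₁ - x₂) ^ 2 := by
        rw [hz]
        ring
      refine .inr ⟨x₃, y₃, h₃, e₃, ?_, ?_⟩
      · rw [hz']
        exact mul_ne_zero (pow_ne_zero 2 (mul_ne_zero hv₁ hv₂)) (pow_ne_zero 2 (sub_ne_zero.mpr hx))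
      · linear_combination hw - (v₁ * v₂) ^ 2 * k - (x₃ + x₄) * hz'

variable [IsAlgClosed F] [W.IsElliptic]

/-- The `x`-coordinate of `n • P` is `(Φₙ : ΨSqₙ)`. -/
theorem representsX_nsmul {x y : F} (h : W.toAffine.Nonsingular x y) (n : ℕ) :
    RepresentsX ((W.Φ n).eval x) ((W.ΨSq n).eval x) (n • Affine.Point.some x y h) := by
  induction n using Nat.strong_induction_on with
  | _ n ih =>
    obtain rfl | rfl | hn : n = 0 ∨ n = 1 ∨ 2 ≤ n := by lia
    · exact .inl (by simp)
    · exact .inr ⟨x, y, h, by simp⟩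
    obtain ⟨m, rfl | rfl⟩ := Nat.even_or_odd' n
    · have := (ih m (by lia)).two_nsmul
      rw [← mul_nsmul'] at this
      push_cast
      rw [Φ_two_mul (by lia), ΨSq_two_mul (by lia)]
      simpa only [eval_add, eval_sub, eval_mul, eval_pow, eval_C, eval_ofNat] using this
    · have Hm := ih m (by lia)
      have Hn := ih (m + 1) (by lia)
      have := Hn.add Hm (by rw [succ_nsmul, add_sub_cancel_left])
        (z := (W.ΨSq (2 * m + 1 : ℕ)).eval x) (w := (W.Φ (2 * m + 1 : ℕ)).eval x) ?_ ?_
      · rwa [← add_nsmul, show m + 1 + m = 2 * m + 1 by ring] at this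
      · push_cast
        rw [ΨSq_two_mul_add_one, eval_pow, eval_sub, eval_mul, eval_mul]
      · have k := congrArg (eval x) (Φ_two_mul_add_one (W := W) (m := m) (by lia))
        simp only [eval_add, eval_mul, eval_pow, eval_X, eval_C, eval_ofNat] at k
        push_cast
        exact k

/-- The roots of the odd division polynomials are the `x`-coordinates of torsion points. -/
theorem nsmul_eq_zero_of_isRoot_preΨ' {x y : F} (h : W.toAffine.Nonsingular x y) {n : ℕ}
    (hx : (W.preΨ' n).IsRoot x) : n • Affine.Point.some x y h = 0 := by
  obtain ⟨h0, -⟩ | ⟨_, _, _, -, h0, -⟩ := representsX_nsmul h n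
  · exact h0
  · rw [ΨSq_ofNat, eval_mul, eval_pow, hx.eq_zero] at h0
    simp at h0

end MultiplicationFormula

/-! ### Square roots of ±n from odd torsion. -/

section SquareClass

variable {F : Type*} [Field F] {W : WeierstrassCurve F}

variable (W) in
/-- `e₁`, `e₂`, `e₃` are the roots of the two-torsion polynomial of `W`. -/
structure IsTwoTorsionRoots (e₁ e₂ e₃ : F) : Prop where
  b₂_eq : W.b₂ = -4 * (e₁ + e₂ + e₃)
  b₄_eq : W.b₄ = 2 * (e₁ * e₂ + e₁ * e₃ + e₂ * e₃)
  b₆_eq : W.b₆ = -4 * (e₁ * e₂ * e₃)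

namespace IsTwoTorsionRoots

variable {e₁ e₂ e₃ : F} (H : W.IsTwoTorsionRoots e₁ e₂ e₃)

include H

lemma swap₁₂ : W.IsTwoTorsionRoots e₂ e₁ e₃ :=
  ⟨by rw [H.b₂_eq]; ring, by rw [H.b₄_eq]; ring, by rw [H.b₆_eq]; ring⟩

lemma swap₁₃ : W.IsTwoTorsionRoots e₃ e₂ e₁ :=
  ⟨by rw [H.b₂_eq]; ring, by rw [H.b₄_eq]; ring, by rw [H.b₆_eq]; ring⟩

lemma tangentDenom_sq {x y : F} (h : W.toAffine.Equation x y) :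
    W.tangentDenom x y ^ 2 = 4 * ((x - e₁) * (x - e₂) * (x - e₃)) := by
  rw [WeierstrassCurve.tangentDenom_sq h, H.b₂_eq, H.b₄_eq, H.b₆_eq]
  ring

lemma eval_Ψ₂Sq : W.Ψ₂Sq.eval e₁ = 0 := by
  simp only [Ψ₂Sq, eval_add, eval_mul, eval_pow, eval_X, eval_C, H.b₂_eq, H.b₄_eq, H.b₆_eq]
  ring

variable [CharZero F]

lemma b₈_eq : W.b₈ = 4 * (e₁ + e₂ + e₃) * (e₁ * e₂ * e₃) -
    (e₁ * e₂ + e₁ * e₃ + e₂ * e₃) ^ 2 := by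
  have hb := W.b_relation
  rw [H.b₂_eq, H.b₄_eq, H.b₆_eq] at hb
  linear_combination hb / 4

lemma Δ_eq : W.Δ = 16 * ((e₁ - e₂) * (e₁ - e₃) * (e₂ - e₃)) ^ 2 := by
  rw [Δ, H.b₈_eq, H.b₂_eq, H.b₄_eq, H.b₆_eq]
  ring

lemma sub_ne_zero [W.IsElliptic] : (e₁ - e₂) * (e₁ - e₃) * (e₂ - e₃) ≠ 0 := by
  intro h
  have := H.Δ_eq
  rw [h, zero_pow two_ne_zero, mul_zero, ← coe_Δ'] at this
  exact W.Δ'.ne_zero this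

/-- At e₁ the polynomial Ψ₂² vanishes and Ψ₃ is minus a square, which is the degenerate recursion.
-/
lemma eval_preΨ' (k : ℕ) : (W.preΨ' (2 * k + 1)).eval e₁ =
    (-1) ^ k * ((e₁ - e₂) * (e₁ - e₃)) ^ (k * (k + 1)) := by
  have h₃ : W.Ψ₃.eval e₁ = -((e₁ - e₂) * (e₁ - e₃)) ^ 2 := by
    simp only [Ψ₃, eval_add, eval_mul, eval_pow, eval_X, eval_C, eval_ofNat,
      H.b₂_eq, H.b₄_eq, H.b₆_eq, H.b₈_eq]
    ring
  rw [← preNormEDS_zero_neg_sq _ (W.preΨ₄.eval e₁), ← preΨ_ofNat, preΨ, ← coe_evalRingHom,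
    map_preNormEDS]
  simp [H.eval_Ψ₂Sq, h₃]

end IsTwoTorsionRoots

lemma exists_isTwoTorsionRoots [IsAlgClosed F] [CharZero F] :
    ∃ e₁ e₂ e₃ : F, W.IsTwoTorsionRoots e₁ e₂ e₃ := by
  have h4 : W.twoTorsionPolynomial.a ≠ 0 := by
    simp [twoTorsionPolynomial]
  obtain ⟨x, y, z, h⟩ := (Cubic.splits_iff_roots_eq_three (φ := RingHom.id F) h4).mp
    (IsAlgClosed.splits _)
  have h₁ := Cubic.b_eq_three_roots h4 h
  have h₂ := Cubic.c_eq_three_roots h4 h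
  have h₃ := Cubic.d_eq_three_roots h4 h
  simp only [twoTorsionPolynomial, RingHom.id_apply] at h₁ h₂ h₃
  refine ⟨x, y, z, ?_, ?_, ?_⟩
  · linear_combination h₁
  · linear_combination h₂ / 2
  · linear_combination h₃

lemma exists_multiset_prod_eq_neg_one_pow_mul_sq {ι : Type*} {K : Subfield F} {f : ι → F}
    (S : Multiset ι) (hS : ∀ a ∈ S, ∃ t ∈ K, f a = -t ^ 2) :
    ∃ s ∈ K, (S.map f).prod = (-1) ^ Multiset.card S * s ^ 2 := by
  induction S using Multiset.induction_on with
  | empty => exact ⟨1, K.one_mem, by simp⟩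
  | cons a S ih =>
    obtain ⟨s, hs, e⟩ := ih fun b hb ↦ hS b (Multiset.mem_cons_of_mem hb)
    obtain ⟨t, ht, e'⟩ := hS a (Multiset.mem_cons_self a S)
    refine ⟨t * s, K.mul_mem ht hs, ?_⟩
    rw [Multiset.map_cons, Multiset.prod_cons, e, e', Multiset.card_cons]
    ring

/-- If the coordinates of the `n`-torsion points, for `n` odd, lie in a field `K` over which the
two-torsion polynomial splits, then `± n ≡ 1 mod 4` is a square in `K`. -/
theorem exists_sq_eq_neg_one_pow_mul [DecidableEq F] [IsAlgClosed F] [CharZero F] [W.IsElliptic]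
    {K : Subfield F} {e₁ e₂ e₃ : F} (H : W.IsTwoTorsionRoots e₁ e₂ e₃) (he₁ : e₁ ∈ K)
    (he₂ : e₂ ∈ K) (he₃ : e₃ ∈ K) (ha₁ : W.a₁ ∈ K) (ha₃ : W.a₃ ∈ K) (k : ℕ)
    (hK : ∀ x y (h : W.toAffine.Nonsingular x y),
      (2 * k + 1) • Affine.Point.some x y h = 0 → x ∈ K ∧ y ∈ K) :
    ∃ s ∈ K, s ^ 2 = (-1) ^ k * (2 * k + 1 : F) := by
  set p := W.preΨ' (2 * k + 1) with hp
  have hn : ((2 * k + 1 : ℕ) : F) ≠ 0 := Nat.cast_ne_zero.mpr (by lia)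
  have hsplit := IsAlgClosed.splits p
  -- The degree (n² - 1)/2 is even, so the signs contributed by the roots cancel.
  have hcard : Multiset.card p.roots = 2 * (k * (k + 1)) := by
    rw [← hsplit.natDegree_eq_card_roots, hp, natDegree_preΨ' _ hn]
    simp only [Nat.not_even_bit1, if_false]
    rw [show (2 * k + 1) ^ 2 = 2 * (2 * (k * (k + 1))) + 1 by ring, Nat.add_sub_cancel,
      Nat.mul_div_cancel_left _ two_pos]
  have hlead : p.leadingCoeff = 2 * k + 1 := by
    rw [hp, leadingCoeff_preΨ' _ hn]
    simp
  have heval (e : F) : p.eval e = (2 * k + 1) * (p.roots.map fun a ↦ e - a).prod := by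
    conv_lhs => rw [hsplit.eq_prod_roots, hlead]
    simp [eval_multiset_prod]
  obtain ⟨s, hs, e⟩ := exists_multiset_prod_eq_neg_one_pow_mul_sq (K := K)
    (f := fun a ↦ (e₁ - a) * (e₂ - a) * (e₃ - a)) p.roots fun a ha ↦ by
      obtain ⟨y, h⟩ := W.exists_nonsingular a
      obtain ⟨hx, hy⟩ := hK a y h (nsmul_eq_zero_of_isRoot_preΨ' h (isRoot_of_mem_roots ha))
      refine ⟨W.tangentDenom a y / 2, ?_, ?_⟩
      · rw [tangentDenom]
        exact div_mem (add_mem (add_mem (mul_mem (ofNat_mem K 2) hy) (mul_mem ha₁ hx)) ha₃)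
          (ofNat_mem K 2)
      · linear_combination H.tangentDenom_sq h.left / 4
  rw [Multiset.prod_map_mul, Multiset.prod_map_mul, hcard] at e
  -- This is the product of the derivatives of ∏ (X - eᵢ) at its roots, hence minus the square of
  -- the Vandermonde product.
  set g := (e₁ - e₂) * (e₁ - e₃) * ((e₂ - e₁) * (e₂ - e₃)) * ((e₃ - e₂) * (e₃ - e₁)) with hg
  have hgK : g ∈ K := by
    simp only [hg]
    exact mul_mem (mul_mem (mul_mem (sub_mem he₁ he₂) (sub_mem he₁ he₃))
      (mul_mem (sub_mem he₂ he₁) (sub_mem he₂ he₃))) (mul_mem (sub_mem he₃ he₂) (sub_mem he₃ he₁))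
  have hg0 : g ≠ 0 := by
    have : g = -((e₁ - e₂) * (e₁ - e₃) * (e₂ - e₃)) ^ 2 := by
      rw [hg]
      ring
    rw [this]
    exact neg_ne_zero.mpr (pow_ne_zero 2 H.sub_ne_zero)
  obtain ⟨r, hr⟩ := Nat.even_mul_succ_self k
  -- Both sides compute p(e₁) p(e₂) p(e₃): over the roots of p, and by the recursion. The exponent
  -- k(k + 1) = 2r makes the power of g a square.
  have key : (2 * k + 1 : F) ^ 3 * s ^ 2 = (-1) ^ k * (g ^ r) ^ 2 := by
    have h₁ := H.eval_preΨ' k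
    have h₂ := H.swap₁₂.eval_preΨ' k
    have h₃ := H.swap₁₃.eval_preΨ' k
    rw [← hp, heval] at h₁ h₂ h₃
    rw [pow_mul, neg_one_sq, one_pow, one_mul] at e
    have h3 : ((-1 : F) ^ k) ^ 3 = (-1) ^ k := by
      rw [← pow_mul, mul_comm, pow_mul]
      norm_num
    calc (2 * k + 1 : F) ^ 3 * s ^ 2 = (-1) ^ k * ((e₁ - e₂) * (e₁ - e₃)) ^ (k * (k + 1)) *
          ((-1) ^ k * ((e₂ - e₁) * (e₂ - e₃)) ^ (k * (k + 1))) *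
          ((-1) ^ k * ((e₃ - e₂) * (e₃ - e₁)) ^ (k * (k + 1))) := by
          rw [← h₁, ← h₂, ← h₃, ← e]
          ring
      _ = ((-1) ^ k) ^ 3 * g ^ (k * (k + 1)) := by
          rw [hg, mul_pow _ ((e₃ - e₂) * (e₃ - e₁)), mul_pow _ ((e₂ - e₁) * (e₂ - e₃))]
          generalize ((e₁ - e₂) * (e₁ - e₃)) ^ (k * (k + 1)) = u₁
          generalize ((e₂ - e₁) * (e₂ - e₃)) ^ (k * (k + 1)) = u₂
          generalize ((e₃ - e₂) * (e₃ - e₁)) ^ (k * (k + 1)) = u₃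
          ring
      _ = (-1) ^ k * (g ^ r) ^ 2 := by
          rw [h3, hr, ← two_mul, ← pow_mul, mul_comm r]
  have hn' : (2 * k + 1 : F) ≠ 0 := by exact_mod_cast hn
  have hs0 : s ≠ 0 := by
    rintro rfl
    rw [zero_pow two_ne_zero, mul_zero] at key
    exact mul_ne_zero (pow_ne_zero k (neg_ne_zero.mpr one_ne_zero))
      (pow_ne_zero 2 (pow_ne_zero r hg0)) key.symm
  have hnK : (2 * k + 1 : F) ∈ K := by exact_mod_cast natCast_mem K (2 * k + 1)
  refine ⟨g ^ r / (s * (2 * k + 1)), div_mem (pow_mem hgK r) (mul_mem hs hnK), ?_⟩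
  have hk1 : ((-1 : F) ^ k) ^ 2 = 1 := by
    rw [← pow_mul, mul_comm, pow_mul, neg_one_sq, one_pow]
  rw [div_pow, div_eq_iff (pow_ne_zero 2 (mul_ne_zero hs0 hn'))]
  linear_combination -(-1) ^ k * key - (g ^ r) ^ 2 * hk1

end SquareClass

/-! ### Halving points, and square roots of -1 and 2. -/

section Halving

variable {F : Type*} [Field F] {W : WeierstrassCurve F} [DecidableEq F]

variable (W) in
/-- The coordinates of all the `n`-torsion points of `W` lie in the subfield `K`. -/
def TorsionDefinedOver (K : Subfield F) (n : ℕ) : Prop :=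
  ∀ x y (h : W.toAffine.Nonsingular x y), n • Affine.Point.some x y h = 0 → x ∈ K ∧ y ∈ K

lemma TorsionDefinedOver.of_dvd {K : Subfield F} {n m : ℕ} (H : W.TorsionDefinedOver K n)
    (hmn : m ∣ n) : W.TorsionDefinedOver K m := by
  obtain ⟨k, rfl⟩ := hmn
  intro x y h h0
  exact H x y h (by rw [mul_nsmul, h0, nsmul_zero])

namespace IsTwoTorsionRoots

variable {e₁ e₂ e₃ : F} (H : W.IsTwoTorsionRoots e₁ e₂ e₃) {K : Subfield F}

include H

variable [CharZero F] [W.IsElliptic]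

lemma exists_two_nsmul_eq_zero : ∃ (y : F) (h : W.toAffine.Nonsingular e₁ y),
    2 • Affine.Point.some e₁ y h = 0 := by
  have ht : W.tangentDenom e₁ (-(W.a₁ * e₁ + W.a₃) / 2) = 0 := by
    rw [tangentDenom]
    ring
  have he : W.toAffine.Equation e₁ (-(W.a₁ * e₁ + W.a₃) / 2) := by
    have h := H.eval_Ψ₂Sq
    simp only [Ψ₂Sq, eval_add, eval_mul, eval_pow, eval_X, eval_C, b₂, b₄, b₆] at h
    rw [Affine.equation_iff]
    linear_combination -h / 4
  exact ⟨_, Affine.equation_iff_nonsingular.mp he, two_nsmul_of_tangentDenom_eq_zero _ ht⟩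

lemma mem_of_torsionDefinedOver (hK : W.TorsionDefinedOver K 2) : e₁ ∈ K := by
  obtain ⟨y, h, h0⟩ := H.exists_two_nsmul_eq_zero
  exact (hK _ _ h h0).1

omit [W.IsElliptic] in
-- The two-descent identity: x(2Q) - e₁ is a square in the field of definition of Q and the eᵢ.
lemma X_sub_mul_tangentDenom_sq {x₀ y₀ x y : F} {h₀ : W.toAffine.Nonsingular x₀ y₀}
    {h : W.toAffine.Nonsingular x y}
    (e : 2 • Affine.Point.some x y h = Affine.Point.some x₀ y₀ h₀) :
    W.tangentDenom x y ≠ 0 ∧ (x₀ - e₁) * W.tangentDenom x y ^ 2 =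
      ((x - e₁) ^ 2 - (e₁ - e₂) * (e₁ - e₃)) ^ 2 := by
  have ht : W.tangentDenom x y ≠ 0 := fun h0 ↦
    Affine.Point.some_ne_zero h₀ (e.symm.trans (two_nsmul_of_tangentDenom_eq_zero h h0))
  refine ⟨ht, ?_⟩
  obtain ⟨_, _, _, e', k, -⟩ := exists_two_nsmul h ht
  obtain ⟨rfl, rfl⟩ := Affine.Point.some.inj (e.symm.trans e')
  rw [H.b₄_eq, H.b₆_eq, H.b₈_eq] at k
  linear_combination k - e₁ * H.tangentDenom_sq h.left

lemma exists_two_nsmul_eq [IsAlgClosed F] {x₀ y₀ : F} (h₀ : W.toAffine.Nonsingular x₀ y₀) :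
    ∃ (x y : F) (h : W.toAffine.Nonsingular x y),
      2 • Affine.Point.some x y h = Affine.Point.some x₀ y₀ h₀ := by
  obtain ⟨s₁, hs₁⟩ := IsAlgClosed.exists_pow_nat_eq (x₀ - e₁) two_pos
  obtain ⟨s₂, hs₂⟩ := IsAlgClosed.exists_pow_nat_eq (x₀ - e₂) two_pos
  obtain ⟨s₃, hs₃⟩ := IsAlgClosed.exists_pow_nat_eq (x₀ - e₃) two_pos
  obtain rfl : e₁ = x₀ - s₁ ^ 2 := by rw [hs₁]; ring
  obtain rfl : e₂ = x₀ - s₂ ^ 2 := by rw [hs₂]; ring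
  obtain rfl : e₃ = x₀ - s₃ ^ 2 := by rw [hs₃]; ring
  -- With this choice x - e₁ = (s₁ + s₂)(s₁ + s₃), and likewise for e₂ and e₃, so 4∏ (x - eᵢ) is
  -- visibly the square of t.
  set x := x₀ + s₁ * s₂ + s₁ * s₃ + s₂ * s₃ with hx
  set t := 2 * ((s₁ + s₂) * (s₁ + s₃) * (s₂ + s₃)) with ht
  set y := (t - W.a₁ * x - W.a₃) / 2 with hy
  have hty : W.tangentDenom x y = t := by
    rw [tangentDenom, hy]
    ring
  have he : W.toAffine.Equation x y := by
    have hb₂ := H.b₂_eq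
    have hb₄ := H.b₄_eq
    have hb₆ := H.b₆_eq
    rw [b₂] at hb₂
    rw [b₄] at hb₄
    rw [b₆] at hb₆
    rw [Affine.equation_iff, hy]
    have : t ^ 2 = 4 * ((x - (x₀ - s₁ ^ 2)) * (x - (x₀ - s₂ ^ 2)) * (x - (x₀ - s₃ ^ 2))) := by
      rw [ht, hx]
      ring
    linear_combination this / 4 - x ^ 2 / 4 * hb₂ - x / 2 * hb₄ - hb₆ / 4
  have h := Affine.equation_iff_nonsingular.mp he
  have ht0 : W.tangentDenom x y ≠ 0 := by
    intro h0
    rw [hty, ht] at h0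
    apply H.sub_ne_zero
    linear_combination -(s₁ - s₂) * (s₁ - s₃) * (s₂ - s₃) / 2 * h0
  obtain ⟨x', y', h', e', k, -⟩ := exists_two_nsmul h ht0
  obtain rfl : x' = x₀ := by
    refine mul_right_cancel₀ (pow_ne_zero 2 ht0) ?_
    rw [k, hty, H.b₄_eq, H.b₆_eq, H.b₈_eq, ht, hx]
    ring
  -- The abscissa fixes the double only up to sign; the half is negated if necessary.
  obtain hp | hp := (Affine.Point.X_eq_iff (h₁ := h') (h₂ := h₀)).mp rfl
  · exact ⟨x, y, h, e'.trans hp⟩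
  · refine ⟨x, _, (Affine.nonsingular_neg x y).mpr h, ?_⟩
    rw [← Affine.Point.neg_some, smul_neg, e', hp, neg_neg]
    exact h

omit [W.IsElliptic] in
lemma exists_sq_eq_X_sub (he₁ : e₁ ∈ K) (he₂ : e₂ ∈ K) (he₃ : e₃ ∈ K) (ha₁ : W.a₁ ∈ K)
    (ha₃ : W.a₃ ∈ K) {x₀ y₀ x y : F} {h₀ : W.toAffine.Nonsingular x₀ y₀}
    {h : W.toAffine.Nonsingular x y}
    (e : 2 • Affine.Point.some x y h = Affine.Point.some x₀ y₀ h₀) (hx : x ∈ K) (hy : y ∈ K) :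
    ∃ s ∈ K, s ^ 2 = x₀ - e₁ := by
  obtain ⟨ht, k⟩ := H.X_sub_mul_tangentDenom_sq e
  refine ⟨((x - e₁) ^ 2 - (e₁ - e₂) * (e₁ - e₃)) / W.tangentDenom x y, ?_, ?_⟩
  · refine div_mem (sub_mem (pow_mem (sub_mem hx he₁) 2)
      (mul_mem (sub_mem he₁ he₂) (sub_mem he₁ he₃))) ?_
    exact add_mem (add_mem (mul_mem (ofNat_mem K 2) hy) (mul_mem ha₁ hx)) ha₃
  · rw [div_pow, ← k, mul_div_cancel_right₀ _ (pow_ne_zero 2 ht)]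

variable [IsAlgClosed F]

/-- A half of the two-torsion point over e₁ is 4-torsion; the descent identity at e₂ makes e₁ - e₂ a
square. -/
lemma exists_sq_eq_sub (hK : W.TorsionDefinedOver K 4) (ha₁ : W.a₁ ∈ K) (ha₃ : W.a₃ ∈ K) :
    ∃ s ∈ K, s ^ 2 = e₁ - e₂ := by
  have hK2 := hK.of_dvd (show 2 ∣ 4 by norm_num)
  obtain ⟨y₀, h₀, e₀⟩ := H.exists_two_nsmul_eq_zero
  obtain ⟨x, y, h, e⟩ := H.exists_two_nsmul_eq h₀
  obtain ⟨hx, hy⟩ := hK x y h (by rw [show 4 = 2 * 2 by rfl, mul_nsmul, e, e₀])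
  exact H.swap₁₂.exists_sq_eq_X_sub (H.swap₁₂.mem_of_torsionDefinedOver hK2)
    (H.mem_of_torsionDefinedOver hK2) (H.swap₁₃.mem_of_torsionDefinedOver hK2) ha₁ ha₃ e hx hy

/-- A field over which the `4`-torsion is defined contains a square root of `-1`. -/
lemma exists_sq_eq_neg_one (hK : W.TorsionDefinedOver K 4) (ha₁ : W.a₁ ∈ K) (ha₃ : W.a₃ ∈ K) :
    ∃ s ∈ K, s ^ 2 = -1 := by
  obtain ⟨s, hs, es⟩ := H.exists_sq_eq_sub hK ha₁ ha₃
  obtain ⟨t, ht, et⟩ := H.swap₁₂.exists_sq_eq_sub hK ha₁ ha₃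
  refine ⟨s / t, div_mem hs ht, ?_⟩
  have h0 : e₂ - e₁ ≠ 0 := by
    intro h
    apply H.sub_ne_zero
    linear_combination -(e₁ - e₃) * (e₂ - e₃) * h
  rw [div_pow, es, et, div_eq_iff h0]
  ring

/-- If 2Q is the two-torsion point over e₁, then (x(Q) - e₁)² = (e₁ - e₂)(e₁ - e₃); and x(Q) - e₁ is
itself a square, because Q is the double of an 8-torsion point. -/
lemma exists_pow_four_eq (hK : W.TorsionDefinedOver K 8) (ha₁ : W.a₁ ∈ K) (ha₃ : W.a₃ ∈ K) :
    ∃ u ∈ K, u ^ 4 = (e₁ - e₂) * (e₁ - e₃) := by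
  have hK2 := hK.of_dvd (show 2 ∣ 8 by norm_num)
  obtain ⟨y₀, h₀, e₀⟩ := H.exists_two_nsmul_eq_zero
  obtain ⟨x, y, h, e⟩ := H.exists_two_nsmul_eq h₀
  obtain ⟨x', y', h', e'⟩ := H.exists_two_nsmul_eq h
  obtain ⟨hx, hy⟩ := hK x' y' h' (by
    rw [show 8 = 2 * 2 * 2 by rfl, mul_nsmul, mul_nsmul, e', e, e₀])
  obtain ⟨u, hu, eu⟩ := H.exists_sq_eq_X_sub (H.mem_of_torsionDefinedOver hK2)
    (H.swap₁₂.mem_of_torsionDefinedOver hK2) (H.swap₁₃.mem_of_torsionDefinedOver hK2) ha₁ ha₃ e'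
    hx hy
  refine ⟨u, hu, ?_⟩
  have k := (H.X_sub_mul_tangentDenom_sq e).2
  rw [sub_self, zero_mul, eq_comm, sq_eq_zero_iff, sub_eq_zero, ← eu] at k
  rw [← k]
  ring

/-- A field over which the `8`-torsion is defined contains a square root of `2`. -/
lemma exists_sq_eq_two (hK : W.TorsionDefinedOver K 8) (ha₁ : W.a₁ ∈ K) (ha₃ : W.a₃ ∈ K) :
    ∃ s ∈ K, s ^ 2 = 2 := by
  have hK4 := hK.of_dvd (show 4 ∣ 8 by norm_num)
  obtain ⟨u₁, hu₁, k₁⟩ := H.exists_pow_four_eq hK ha₁ ha₃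
  obtain ⟨u₂, hu₂, k₂⟩ := H.swap₁₂.exists_pow_four_eq hK ha₁ ha₃
  obtain ⟨u₃, hu₃, k₃⟩ := H.swap₁₃.exists_pow_four_eq hK ha₁ ha₃
  obtain ⟨v₁, hv₁, l₁⟩ := H.exists_sq_eq_sub hK4 ha₁ ha₃
  obtain ⟨v₂, hv₂, l₂⟩ := H.swap₁₂.swap₁₃.exists_sq_eq_sub hK4 ha₁ ha₃
  obtain ⟨v₃, hv₃, l₃⟩ := H.swap₁₃.swap₁₂.exists_sq_eq_sub hK4 ha₁ ha₃
  set τ := v₁ * v₂ * v₃ with hτ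
  -- A primitive eighth root of unity; its sum with its inverse is z - z³ = ±√2.
  set z := u₁ * u₂ * u₃ / τ with hz
  have hzK : z ∈ K := div_mem (mul_mem (mul_mem hu₁ hu₂) hu₃) (mul_mem (mul_mem hv₁ hv₂) hv₃)
  have hd : τ ^ 4 = ((e₁ - e₂) * (e₁ - e₃) * (e₂ - e₃)) ^ 2 := by
    rw [show τ ^ 4 = (v₁ ^ 2 * v₂ ^ 2 * v₃ ^ 2) ^ 2 by rw [hτ]; ring, l₁, l₂, l₃]
    ring
  have hz4 : z ^ 4 = -1 := by
    rw [hz, div_pow, mul_pow, mul_pow, k₁, k₂, k₃, hd, div_eq_iff (pow_ne_zero 2 H.sub_ne_zero)]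
    ring
  refine ⟨z - z ^ 3, sub_mem hzK (pow_mem hzK 3), ?_⟩
  linear_combination (z ^ 2 - 2) * hz4

end IsTwoTorsionRoots

end Halving

/-! ### Torsion of coprime orders. -/

section CoprimeTorsion

variable {F : Type*} [Field F] {W : WeierstrassCurve F} [DecidableEq F] {K : Subfield F}

lemma slope_mem (ha₁ : W.a₁ ∈ K) (ha₂ : W.a₂ ∈ K) (ha₃ : W.a₃ ∈ K) (ha₄ : W.a₄ ∈ K)
    {x₁ y₁ x₂ y₂ : F} (hx₁ : x₁ ∈ K) (hy₁ : y₁ ∈ K) (hx₂ : x₂ ∈ K) (hy₂ : y₂ ∈ K) :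
    W.toAffine.slope x₁ x₂ y₁ y₂ ∈ K := by
  rw [Affine.slope, Affine.negY, Affine.negY]
  split_ifs
  · exact K.zero_mem
  · refine div_mem (sub_mem (add_mem (add_mem (mul_mem (ofNat_mem K 3) (pow_mem hx₁ 2)) ?_) ha₄) ?_)
      (sub_mem hy₁ (sub_mem (sub_mem (neg_mem hy₁) (mul_mem ha₁ hx₁)) ha₃))
    · exact mul_mem (mul_mem (ofNat_mem K 2) ha₂) hx₁
    · exact mul_mem ha₁ hy₁
  · exact div_mem (sub_mem hy₁ hy₂) (sub_mem hx₁ hx₂)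

variable (W) in
/-- The subgroup of the points whose coordinates lie in a subfield `K` that contains the
coefficients of `W`. -/
def pointsOver (K : Subfield F) (ha₁ : W.a₁ ∈ K) (ha₂ : W.a₂ ∈ K) (ha₃ : W.a₃ ∈ K)
    (ha₄ : W.a₄ ∈ K) : AddSubgroup W.toAffine.Point where
  carrier := {Q | Q = 0 ∨ ∃ x y h, Q = Affine.Point.some x y h ∧ x ∈ K ∧ y ∈ K}
  zero_mem' := .inl rfl
  add_mem' {A B} hA hB := by
    obtain rfl | ⟨x₁, y₁, h₁, rfl, hx₁, hy₁⟩ := hA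
    · rwa [zero_add]
    obtain rfl | ⟨x₂, y₂, h₂, rfl, hx₂, hy₂⟩ := hB
    · exact .inr ⟨x₁, y₁, h₁, add_zero _, hx₁, hy₁⟩
    by_cases hxy : x₁ = x₂ ∧ y₁ = W.toAffine.negY x₂ y₂
    · exact .inl (Affine.Point.add_of_Y_eq hxy.1 hxy.2)
    · have hs := slope_mem ha₁ ha₂ ha₃ ha₄ hx₁ hy₁ hx₂ hy₂
      have hX : W.toAffine.addX x₁ x₂ (W.toAffine.slope x₁ x₂ y₁ y₂) ∈ K :=
        sub_mem (sub_mem (sub_mem (add_mem (pow_mem hs 2) (mul_mem ha₁ hs)) ha₂) hx₁) hx₂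
      refine .inr ⟨_, _, _, Affine.Point.add_some hxy, hX, ?_⟩
      rw [Affine.addY, Affine.negY, Affine.negAddY]
      exact sub_mem (sub_mem (neg_mem (add_mem (mul_mem hs (sub_mem hX hx₁)) hy₁))
        (mul_mem ha₁ hX)) ha₃
  neg_mem' {A} hA := by
    obtain rfl | ⟨x, y, h, rfl, hx, hy⟩ := hA
    · exact .inl neg_zero
    · exact .inr ⟨_, _, _, Affine.Point.neg_some h, hx,
        sub_mem (sub_mem (neg_mem hy) (mul_mem ha₁ hx)) ha₃⟩

/-- By Bézout, P is an integral combination of aP, which is b-torsion, and bP, which is a-torsion;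
the points over K form a group. -/
lemma TorsionDefinedOver.mul_of_coprime {a b : ℕ} (ha₁ : W.a₁ ∈ K) (ha₂ : W.a₂ ∈ K)
    (ha₃ : W.a₃ ∈ K) (ha₄ : W.a₄ ∈ K) (hab : a.Coprime b) (Ha : W.TorsionDefinedOver K a)
    (Hb : W.TorsionDefinedOver K b) : W.TorsionDefinedOver K (a * b) := by
  intro x y h h0
  set P := Affine.Point.some x y h with hP
  have key {n : ℕ} (Hn : W.TorsionDefinedOver K n) {Q : W.toAffine.Point} (hQ : n • Q = 0) :
      Q ∈ W.pointsOver K ha₁ ha₂ ha₃ ha₄ := by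
    rcases Q with _ | ⟨x', y', h'⟩
    · exact .inl rfl
    · exact .inr ⟨x', y', h', rfl, Hn x' y' h' hQ⟩
  have hmem : P ∈ W.pointsOver K ha₁ ha₂ ha₃ ha₄ := by
    have hbez := Nat.gcd_eq_gcd_ab a b
    rw [hab.gcd_eq_one, Nat.cast_one] at hbez
    have : P = a.gcdA b • (a • P) + a.gcdB b • (b • P) := by
      rw [← natCast_zsmul P a, ← natCast_zsmul P b, ← mul_zsmul, ← mul_zsmul, ← add_zsmul,
        mul_comm _ (a : ℤ), mul_comm _ (b : ℤ), ← hbez, one_zsmul]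
    rw [this]
    refine add_mem (zsmul_mem (key Hb ?_) _) (zsmul_mem (key Ha ?_) _)
    · rw [← mul_nsmul, h0]
    · rw [← mul_nsmul', h0]
  obtain h0 | ⟨x', y', h', e, hx, hy⟩ := hmem
  · exact absurd h0 (Affine.Point.some_ne_zero h)
  · obtain ⟨rfl, rfl⟩ := Affine.Point.some.inj e
    exact ⟨hx, hy⟩

end CoprimeTorsion

end WeierstrassCurve

/-! ### Division fields and the square root of -3. -/

section DivisionField

open WeierstrassCurve

open scoped Classical in
lemma divisionField_le_iff {E : WeierstrassCurve ℚ} {n : ℕ}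
    {K : IntermediateField ℚ (AlgebraicClosure ℚ)} : divisionField E n ≤ K ↔
      (E.baseChange (AlgebraicClosure ℚ)).TorsionDefinedOver K.toSubfield n := by
  rw [divisionField, IntermediateField.adjoin_le_iff]
  constructor
  · intro H x y h h0
    exact ⟨H ⟨x, y, h, h0, .inl rfl⟩, H ⟨x, y, h, h0, .inr rfl⟩⟩
  · rintro H z ⟨x, y, h, h0, rfl | rfl⟩
    · exact (H _ _ h h0).1
    · exact (H _ _ h h0).2

lemma mem_of_sq_eq_neg_three {F : Type*} [Field F] [CharZero F] {K : Subfield F} {ζ r : F}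
    (hζ : IsPrimitiveRoot ζ 3) (hr : r ∈ K) (h : r ^ 2 = -3) : ζ ∈ K := by
  have h1 : ζ ^ 2 + ζ + 1 = 0 := by
    have h3 := hζ.pow_eq_one
    have hne := sub_ne_zero.mpr (hζ.ne_one (by norm_num))
    apply mul_left_cancel₀ hne
    linear_combination h3
  have h2 : (2 * ζ + 1 - r) * (2 * ζ + 1 + r) = 0 := by linear_combination 4 * h1 - h
  obtain h2 | h2 := mul_eq_zero.mp h2
  · rw [show ζ = (r - 1) / 2 by linear_combination h2 / 2]
    exact div_mem (sub_mem hr K.one_mem) (ofNat_mem K 2)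
  · rw [show ζ = (-r - 1) / 2 by linear_combination h2 / 2]
    exact div_mem (sub_mem (neg_mem hr) K.one_mem) (ofNat_mem K 2)

/-- The arithmetic of the squarefree part `D = 3 B`: a field that contains suitable square roots
contains a square root of `-3`. -/
lemma exists_sq_eq_neg_three {F : Type*} [Field F] [CharZero F] {K : Subfield F} {B : ℤ} {m : ℕ}
    (hB : B ≠ 0) (h4 : ¬ (4 : ℤ) ∣ B)
    (hm : m = if 3 * B ≡ 1 [ZMOD 4] then 2 * B.natAbs else 4 * B.natAbs)
    (hd : ∃ d ∈ K, d ^ 2 = ((3 * B : ℤ) : F))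
    (hodd : ∀ k : ℕ, 2 * k + 1 ∣ m → ∃ s ∈ K, s ^ 2 = (-1) ^ k * (2 * k + 1 : F))
    (hi : 4 ∣ m → ∃ s ∈ K, s ^ 2 = -1) (h2 : 8 ∣ m → ∃ s ∈ K, s ^ 2 = 2) :
    ∃ r ∈ K, r ^ 2 = -3 := by
  obtain ⟨d, hd, ed⟩ := hd
  have hB' : (B : F) ≠ 0 := Int.cast_ne_zero.mpr hB
  have hBK : (B : F) ∈ K := intCast_mem K B
  suffices ∃ s ∈ K, s ^ 2 = -(B : F) by
    obtain ⟨s, hs, es⟩ := this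
    refine ⟨d * s / B, div_mem (mul_mem hd hs) hBK, ?_⟩
    rw [div_pow, mul_pow, ed, es, div_eq_iff (pow_ne_zero 2 hB')]
    push_cast
    ring
  split_ifs at hm with hc
  -- Here -B ≡ 1 mod 4, so (-1)^k |B| is exactly -B and no square root of -1 is needed.
  · rw [Int.ModEq] at hc
    obtain ⟨k, hk⟩ : ∃ k, B.natAbs = 2 * k + 1 := ⟨B.natAbs / 2, by lia⟩
    obtain ⟨s, hs, es⟩ := hodd k (by rw [hm, hk]; exact dvd_mul_left _ _)
    refine ⟨s, hs, es.trans ?_⟩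
    obtain ⟨j, rfl | rfl⟩ := Nat.even_or_odd' k
    · have : B = -(2 * (2 * j : ℕ) + 1) := by lia
      rw [this, pow_mul, neg_one_sq, one_pow]
      push_cast
      ring
    · have : B = 2 * (2 * j + 1 : ℕ) + 1 := by lia
      rw [this, pow_succ, pow_mul, neg_one_sq, one_pow]
      push_cast
      ring
  · obtain ⟨i, hiK, ei⟩ := hi ⟨_, hm⟩
    -- As 4 divides m, a square root of -1 is available and the sign of B is immaterial.
    suffices ∃ s ∈ K, s ^ 2 = (B : F) ∨ s ^ 2 = -(B : F) by
      obtain ⟨s, hs, es | es⟩ := this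
      · exact ⟨i * s, mul_mem hiK hs, by rw [mul_pow, ei, es, neg_one_mul]⟩
      · exact ⟨s, hs, es⟩
    have key {C : ℤ} {k : ℕ} (hk : C.natAbs = 2 * k + 1) (hkm : 2 * k + 1 ∣ m) :
        ∃ s ∈ K, s ^ 2 = (C : F) ∨ s ^ 2 = -(C : F) := by
      obtain ⟨s, hs, es⟩ := hodd k hkm
      refine ⟨s, hs, ?_⟩
      have hC : (2 * k + 1 : F) = C ∨ (2 * k + 1 : F) = -C := by
        obtain h | h : (2 * k + 1 : ℤ) = C ∨ (2 * k + 1 : ℤ) = -C := by lia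
        · exact .inl (by exact_mod_cast congrArg (Int.cast : ℤ → F) h)
        · exact .inr (by exact_mod_cast congrArg (Int.cast : ℤ → F) h)
      obtain h1 | h1 := neg_one_pow_eq_or F k <;> obtain h | h := hC <;> rw [es, h1, h] <;> simp
    -- If B = 2C, then C is odd and 8 divides m, so √2 supplies the even part.
    obtain ⟨C, rfl | rfl⟩ := Int.even_or_odd' B
    · obtain ⟨k, hk⟩ : ∃ k, C.natAbs = 2 * k + 1 := ⟨C.natAbs / 2, by lia⟩
      obtain ⟨t, ht, et⟩ := h2 ⟨C.natAbs, by rw [hm, Int.natAbs_mul]; norm_num; ring⟩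
      obtain ⟨s, hs, es⟩ := key hk (by
        rw [hm, Int.natAbs_mul, hk, ← mul_assoc]; exact dvd_mul_left _ _)
      refine ⟨t * s, mul_mem ht hs, ?_⟩
      push_cast
      rw [mul_pow, et]
      exact es.imp (by rintro h; rw [h]) (by rintro h; rw [h, mul_neg])
    · obtain ⟨k, hk⟩ : ∃ k, (2 * C + 1).natAbs = 2 * k + 1 := ⟨(2 * C + 1).natAbs / 2, by lia⟩
      exact key hk (by rw [hm, hk]; exact dvd_mul_left _ _)

end DivisionField

theorem mainTheorem11 (E : WeierstrassCurve ℚ) [E.IsElliptic]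
    (ζ : AlgebraicClosure ℚ) (hζ : IsPrimitiveRoot ζ 3)
    (hE : divisionField E 3 = IntermediateField.adjoin ℚ {ζ})
    (D : ℤ) (hD : IsSquarefreePart D E.Δ) (h3 : 3 ∣ D)
    (m : ℕ) (hm : 3 * m = if D ≡ 1 [ZMOD 4] then 2 * D.natAbs else 4 * D.natAbs) :
    divisionField E m = divisionField E (3 * m) := by
  classical
  obtain ⟨hsq, q, hq, hΔ⟩ := hD
  obtain ⟨B, rfl⟩ := h3
  have hB : B ≠ 0 := fun h ↦ hsq.ne_zero (by rw [h, mul_zero])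
  have h3B : ¬ (3 : ℤ) ∣ B := fun ⟨c, hc⟩ ↦ by
    have := Int.isUnit_iff.mp (hsq 3 ⟨c, by rw [hc, mul_assoc]⟩)
    lia
  have h4B : ¬ (4 : ℤ) ∣ B := fun ⟨c, hc⟩ ↦ by
    have := Int.isUnit_iff.mp (hsq 2 ⟨3 * c, by rw [hc]; ring⟩)
    lia
  have hm' : m = if 3 * B ≡ 1 [ZMOD 4] then 2 * B.natAbs else 4 * B.natAbs := by
    rw [Int.natAbs_mul] at hm
    split_ifs at hm ⊢ <;> lia
  have h2m : 2 ∣ m := by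
    rw [hm']
    split_ifs <;> lia
  have hcop : Nat.Coprime 3 m := by
    rw [Nat.Prime.coprime_iff_not_dvd Nat.prime_three, hm']
    split_ifs <;> lia
  set K := divisionField E m with hK
  set W := E.baseChange (AlgebraicClosure ℚ) with hW
  have : W.IsElliptic := inferInstanceAs (E.map _).IsElliptic
  have HK : W.TorsionDefinedOver K.toSubfield m := divisionField_le_iff.mp le_rfl
  have hQ (a : ℚ) : algebraMap ℚ (AlgebraicClosure ℚ) a ∈ K.toSubfield := K.algebraMap_mem a
  obtain ⟨e₁, e₂, e₃, H⟩ := W.exists_isTwoTorsionRoots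
  have hK2 := HK.of_dvd h2m
  have he₁ := H.mem_of_torsionDefinedOver hK2
  have he₂ := H.swap₁₂.mem_of_torsionDefinedOver hK2
  have he₃ := H.swap₁₃.mem_of_torsionDefinedOver hK2
  have hd : ∃ d ∈ K.toSubfield, d ^ 2 = ((3 * B : ℤ) : AlgebraicClosure ℚ) := by
    have hq' : algebraMap ℚ (AlgebraicClosure ℚ) q ≠ 0 := by simpa using hq
    -- The numerator is a square root of Δ = D q².
    refine ⟨4 * ((e₁ - e₂) * (e₁ - e₃) * (e₂ - e₃)) / algebraMap ℚ _ q, div_mem (mul_mem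
      (ofNat_mem _ 4) (mul_mem (mul_mem (sub_mem he₁ he₂) (sub_mem he₁ he₃)) (sub_mem he₂ he₃)))
      (hQ q), ?_⟩
    have hΔ' : W.Δ = ((3 * B : ℤ) : AlgebraicClosure ℚ) * algebraMap ℚ _ q ^ 2 := by
      rw [hW, WeierstrassCurve.baseChange, WeierstrassCurve.map_Δ, hΔ]
      simp
    rw [div_pow, div_eq_iff (pow_ne_zero 2 hq'), ← hΔ', H.Δ_eq]
    ring
  have hζK : ζ ∈ K.toSubfield := by
    obtain ⟨r, hr, er⟩ := exists_sq_eq_neg_three hB h4B hm' hd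
      (fun k hk ↦ WeierstrassCurve.exists_sq_eq_neg_one_pow_mul H he₁ he₂ he₃ (hQ _) (hQ _) k
        (HK.of_dvd hk))
      (fun h ↦ H.exists_sq_eq_neg_one (HK.of_dvd h) (hQ _) (hQ _))
      (fun h ↦ H.exists_sq_eq_two (HK.of_dvd h) (hQ _) (hQ _))
    exact mem_of_sq_eq_neg_three hζ hr er
  have HK3 : W.TorsionDefinedOver K.toSubfield 3 := by
    refine divisionField_le_iff.mp (hE.trans_le ?_)
    rw [IntermediateField.adjoin_le_iff, Set.singleton_subset_iff]
    exact hζK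
  refine le_antisymm (divisionField_le_iff.mpr ?_) (divisionField_le_iff.mpr ?_)
  · exact (divisionField_le_iff.mp le_rfl).of_dvd (dvd_mul_left m 3)
  · exact HK3.mul_of_coprime (hQ _) (hQ _) (hQ _) (hQ _) hcop HK
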